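/- Let $\mathcal C$ be a braided monoidal category (tensor product $\otimes$, unit $K$, braiding $c$; associativity and unit constraints are suppressed) that admits coequalizers; in particular idempotents split in $\mathcal C$. An object is used to denote its identity morphism. A weak Hopf quasigroup in $\mathcal C$ is an object $H$ with a unital magma structure $(\eta_H,\mu_H)$ (two-sided unit, product not necessarily associative) and a comonoid structure $(\varepsilon_H,\delta_H)$ such that (a1) $\delta_H\circ\mu_H=(\mu_H\otimes\mu_H)\circ(H\otimes c_{H,H}\otimes H)\circ(\delta_H\otimes\delta_H)$; (a2) $\varepsilon_H\mu_H(\mu_H\otimes H)=\varepsilon_H\mu_H(H\otimes\mu_H)=(\varepsilon_H\mu_H\otimes\varepsilon_H\mu_H)(H\otimes\delta_H\otimes H)=(\varepsilon_H\mu_H\otimes\varepsilon_H\mu_H)(H\otimes c_{H,H}^{-1}\delta_H\otimes H)$; (a3) $(\delta_H\otimes H)\delta_H\eta_H=(H\otimes\mu_H\otimes H)(\delta_H\eta_H\otimes\delta_H\eta_H)=(H\otimes\mu_Hc_{H,H}^{-1}\otimes H)(\delta_H\eta_H\otimes\delta_H\eta_H)$; (a4) there is $\lambda_H:H\to H$ such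 that, with $f*g=\mu_H(f\otimes g)\delta_H$, $\Pi^L_H=id_H*\lambda_H$ and $\Pi^R_H=\lambda_H*id_H$: $\Pi^L_H=(\varepsilon_H\mu_H\otimes H)(H\otimes c_{H,H})(\delta_H\eta_H\otimes H)$; $\Pi^R_H=(H\otimes\varepsilon_H\mu_H)(c_{H,H}\otimes H)(H\otimes\delta_H\eta_H)$; $\lambda_H*\Pi^L_H=\Pi^R_H*\lambda_H=\lambda_H$; $\mu_H(\lambda_H\otimes\mu_H)(\delta_H\otimes H)=\mu_H(\Pi^R_H\otimes H)$; $\mu_H(H\otimes\mu_H)(H\otimes\lambda_H\otimes H)(\delta_H\otimes H)=\mu_H(\Pi^L_H\otimes H)$; $\mu_H(\mu_H\otimes\lambda_H)(H\otimes\delta_H)=\mu_H(H\otimes\Pi^L_H)$; $\mu_H(\mu_H\otimes H)(H\otimes\lambda_H\otimes H)(H\otimes\delta_H)=\mu_H(H\otimes\Pi^R_H)$. A right-right $H$-Hopf module is a triple $(M,\phi_M:M\otimes H\to M,\rho_M:M\to M\otimes H)$ such that $(M,\rho_M)$ is a right $H$-comodule, $\phi_M(M\otimes\eta_H)=id_M$,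 $\rho_M\phi_M=(\phi_M\otimes\mu_H)(M\otimes c_{H,H}\otimes H)(\rho_M\otimes\delta_H)$, $\phi_M(\phi_M\otimes\lambda_H)(M\otimes\delta_H)=\phi_M(M\otimes\Pi^L_H)$, $\phi_M(\phi_M\otimes H)(M\otimes\lambda_H\otimes H)(M\otimes\delta_H)=\phi_M(M\otimes\Pi^R_H)$ and $\phi_M(\phi_M\otimes H)(M\otimes\Pi^L_H\otimes H)(M\otimes\delta_H)=\phi_M$. For a Hopf module $M$ put $q_M=\phi_M(M\otimes\lambda_H)\rho_M$. A morphism $f:M\to N$ of Hopf modules (a morphism in $\mathcal M^H_H$) is a morphism of $\mathcal C$ with $\rho_Nf=(f\otimes H)\rho_M$ and $\phi^{\alpha}_N(f\otimes H)=f\phi^{\alpha}_M$, where $\phi^{\alpha}_M=\phi_M(q_M\otimes\mu_H)(\rho_M\otimes H)$. Let $H$ be a weak Hopf quasigroup in $\mathcal C$ such that the functor $-\otimes H$ preserves coequalizers. Then: (1) $\Pi^L_H$ is idempotent. Let $H_L$ be its image, with $\Pi^L_H=i_Lp_L$, $p_Li_L=id_{H_L}$. Then $H_L$ is a monoid with unit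 $p_L\eta_H$ and product $p_L\mu_H(i_L\otimes i_L)$. Put $\varphi_H=\mu_H(i_L\otimes H)$. Let $(M,\phi_M,\rho_M)$ be a strong Hopf module, that is, a Hopf module with $\phi_M(\phi_M(M\otimes i_L)\otimes H)=\phi_M(M\otimes\mu_H(i_L\otimes H))$. (2) $q_M$ is idempotent. Let $M^{coH}$ be its image, with $q_M=i_Mp_M$, $p_Mi_M=id$. Then $\psi=p_M\phi_M(i_M\otimes i_L)$ makes $M^{coH}$ a right $H_L$-module. Let $n:M^{coH}\otimes H\to M^{coH}\otimes_{H_L}H$ be the coequalizer of $\psi\otimes H$ and $M^{coH}\otimes\varphi_H$. (3) $\nabla_M=(p_M\otimes H)\rho_M\phi_M(i_M\otimes H)$ is idempotent. Let $M^{coH}\times H$ be its image, with $\nabla_M=ip$, $pi=id$. Then $M^{coH}\times H$ is a Hopf module with action $p(M^{coH}\otimes\mu_H)(i\otimes H)$ and coaction $(p\otimes H)(M^{coH}\otimes\delta_H)i$. (4) There are $\phi:(M^{coH}\otimes_{H_L}H)\otimes H\to M^{coH}\otimes_{H_L}H$ and $\rho:M^{coH}\otimes_{H_L}H\to(M^{coH}\otimes_{H_L}H)\otimes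 H$ with $\phi(n\otimes H)=n(M^{coH}\otimes\mu_H)$ and $\rho n=(n\otimes H)(M^{coH}\otimes\delta_H)$, and they make $M^{coH}\otimes_{H_L}H$ a Hopf module. (5) There is an isomorphism $s:M^{coH}\otimes_{H_L}H\to M^{coH}\times H$ in $\mathcal M^H_H$ with $s\circ n=p$. (6) $p:M^{coH}\otimes H\to M^{coH}\times H$ is a coequalizer of $\psi\otimes H$ and $M^{coH}\otimes\varphi_H$. All this holds for any choice of the images (splittings) involved. -/

import Mathlib

open CategoryTheory MonoidalCategory Limits
open scoped ComonObj

/-- A unital magma in a monoidal category: a two-sided unit, a product, no associativity. -/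
class UnitalMagmaObj {C : Type*} [Category C] [MonoidalCategory C] (X : C) where
  one : 𝟙_ C ⟶ X
  mul : X ⊗ X ⟶ X
  one_mul : one ▷ X ≫ mul = (λ_ X).hom
  mul_one : X ◁ one ≫ mul = (ρ_ X).hom

notation "one[" A "]" => UnitalMagmaObj.one (X := A)
notation "mul[" A "]" => UnitalMagmaObj.mul (X := A)

/-- The data of a weak Hopf quasigroup: a unital magma, a comonoid and a morphism `antipode`. -/
class WeakHopfQuasigroupData {C : Type*} [Category C] [MonoidalCategory C] (H : C) extends
    UnitalMagmaObj H, ComonObj H where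
  antipode : H ⟶ H

notation "anti[" A "]" => WeakHopfQuasigroupData.antipode (H := A)

section Convolution

variable {C : Type*} [Category C] [MonoidalCategory C] (H : C) [WeakHopfQuasigroupData H]

/-- The convolution product `f * g` of two endomorphisms. -/
def convolution {H : C} [WeakHopfQuasigroupData H] (f g : H ⟶ H) : H ⟶ H :=
  Δ[H] ≫ (f ⊗ₘ g) ≫ mul[H]

/-- The target morphism `Πᴸ = id * antipode`. -/
def targetMap : H ⟶ H := convolution (𝟙 H) anti[H]

/-- The source morphism `Πᴿ = antipode * id`. -/
def sourceMap : H ⟶ H := convolution anti[H] (𝟙 H)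

end Convolution

/-- A weak Hopf quasigroup in a braided monoidal category. (The antipode is determined by the
other data, so recording it as data is harmless.) -/
class WeakHopfQuasigroup {C : Type*} [Category C] [MonoidalCategory C] [BraidedCategory C]
    (H : C) extends WeakHopfQuasigroupData H where
  /-- The coproduct is multiplicative. -/
  mul_comul : mul[H] ≫ Δ[H] = (Δ[H] ⊗ₘ Δ[H]) ≫ tensorμ H H H H ≫ (mul[H] ⊗ₘ mul[H])
  /-- Weak multiplicativity of the counit. -/
  counit_assoc :
    mul[H] ▷ H ≫ mul[H] ≫ ε[H] = (α_ H H H).hom ≫ H ◁ mul[H] ≫ mul[H] ≫ ε[H]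
  counit_split :
    mul[H] ▷ H ≫ mul[H] ≫ ε[H] =
      (H ◁ Δ[H]) ▷ H ≫ (α_ H H H).inv ▷ H ≫ (α_ (H ⊗ H) H H).hom ≫
        ((mul[H] ≫ ε[H]) ⊗ₘ (mul[H] ≫ ε[H])) ≫ (λ_ (𝟙_ C)).hom
  counit_split_braided :
    mul[H] ▷ H ≫ mul[H] ≫ ε[H] =
      (H ◁ (Δ[H] ≫ (β_ H H).inv)) ▷ H ≫ (α_ H H H).inv ▷ H ≫ (α_ (H ⊗ H) H H).hom ≫
        ((mul[H] ≫ ε[H]) ⊗ₘ (mul[H] ≫ ε[H])) ≫ (λ_ (𝟙_ C)).hom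
  /-- Weak comultiplicativity of the unit. -/
  unit_split :
    one[H] ≫ Δ[H] ≫ Δ[H] ▷ H =
      (λ_ (𝟙_ C)).inv ≫ ((one[H] ≫ Δ[H]) ⊗ₘ (one[H] ≫ Δ[H])) ≫
        (α_ (H ⊗ H) H H).inv ≫ (α_ H H H).hom ▷ H ≫ (H ◁ mul[H]) ▷ H
  unit_split_braided :
    one[H] ≫ Δ[H] ≫ Δ[H] ▷ H =
      (λ_ (𝟙_ C)).inv ≫ ((one[H] ≫ Δ[H]) ⊗ₘ (one[H] ≫ Δ[H])) ≫
        (α_ (H ⊗ H) H H).inv ≫ (α_ H H H).hom ▷ H ≫ (H ◁ ((β_ H H).inv ≫ mul[H])) ▷ H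
  /-- The antipode axioms. -/
  target_eq :
    targetMap H =
      (λ_ H).inv ≫ (one[H] ≫ Δ[H]) ▷ H ≫ (α_ H H H).hom ≫ H ◁ (β_ H H).hom ≫
        (α_ H H H).inv ≫ (mul[H] ≫ ε[H]) ▷ H ≫ (λ_ H).hom
  source_eq :
    sourceMap H =
      (ρ_ H).inv ≫ H ◁ (one[H] ≫ Δ[H]) ≫ (α_ H H H).inv ≫ (β_ H H).hom ▷ H ≫
        (α_ H H H).hom ≫ H ◁ (mul[H] ≫ ε[H]) ≫ (ρ_ H).hom
  antipode_conv_target : convolution anti[H] (targetMap H) = anti[H]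
  source_conv_antipode : convolution (sourceMap H) anti[H] = anti[H]
  antipode_mul_mul :
    Δ[H] ▷ H ≫ (α_ H H H).hom ≫ (anti[H] ⊗ₘ mul[H]) ≫ mul[H] = sourceMap H ▷ H ≫ mul[H]
  mul_antipode_mul :
    Δ[H] ▷ H ≫ (α_ H H H).hom ≫ H ◁ (anti[H] ▷ H) ≫ H ◁ mul[H] ≫ mul[H] =
      targetMap H ▷ H ≫ mul[H]
  mul_mul_antipode :
    H ◁ Δ[H] ≫ (α_ H H H).inv ≫ (mul[H] ⊗ₘ anti[H]) ≫ mul[H] = H ◁ targetMap H ≫ mul[H]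
  mul_antipode_mul' :
    H ◁ Δ[H] ≫ (α_ H H H).inv ≫ (H ◁ anti[H]) ▷ H ≫ mul[H] ▷ H ≫ mul[H] =
      H ◁ sourceMap H ≫ mul[H]

/-- A splitting of an endomorphism `e` (which is then idempotent): its image `obj` with the
inclusion `ι` and the projection `π`. -/
structure IdempotentSplitting {C : Type*} [Category C] {X : C} (e : X ⟶ X) where
  obj : C
  ι : obj ⟶ X
  π : X ⟶ obj
  ι_π : ι ≫ π = 𝟙 obj
  π_ι : π ≫ ι = e

section Structures

variable {C : Type*} [Category C] [MonoidalCategory C] [BraidedCategory C]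
variable (H : C) [WeakHopfQuasigroup H]

/-- `(X, φ, ρ)` is a right-right `H`-Hopf module. -/
structure IsHopfModule {X : C} (φ : X ⊗ H ⟶ X) (ρ : X ⟶ X ⊗ H) : Prop where
  coact_counit : ρ ≫ X ◁ ε[H] ≫ (ρ_ X).hom = 𝟙 X
  coact_coact : ρ ≫ ρ ▷ H ≫ (α_ X H H).hom = ρ ≫ X ◁ Δ[H]
  act_one : X ◁ one[H] ≫ φ = (ρ_ X).hom
  act_coact : φ ≫ ρ = (ρ ⊗ₘ Δ[H]) ≫ tensorμ X H H H ≫ (φ ⊗ₘ mul[H])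
  act_act_antipode :
    X ◁ Δ[H] ≫ (α_ X H H).inv ≫ (φ ⊗ₘ anti[H]) ≫ φ = X ◁ targetMap H ≫ φ
  act_antipode_act :
    X ◁ Δ[H] ≫ (α_ X H H).inv ≫ (X ◁ anti[H]) ▷ H ≫ φ ▷ H ≫ φ = X ◁ sourceMap H ≫ φ
  act_target_act :
    X ◁ Δ[H] ≫ (α_ X H H).inv ≫ (X ◁ targetMap H) ▷ H ≫ φ ▷ H ≫ φ = φ

/-- A right-right `H`-Hopf module. -/
structure HopfModule where
  X : C
  act : X ⊗ H ⟶ X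
  coact : X ⟶ X ⊗ H
  isHopfModule : IsHopfModule H act coact

end Structures

namespace HopfModule

variable {C : Type*} [Category C] [MonoidalCategory C] [BraidedCategory C]
variable {H : C} [WeakHopfQuasigroup H] (M : HopfModule H)

/-- The morphism `q_M`, whose image is the object of coinvariants. -/
def coinvMap : M.X ⟶ M.X := M.coact ≫ M.X ◁ anti[H] ≫ M.act

variable (Q : IdempotentSplitting M.coinvMap)

/-- The morphism `ω_M : M^{coH} ⊗ H ⟶ M`. -/
def omega : Q.obj ⊗ H ⟶ M.X := Q.ι ▷ H ≫ M.act

/-- The morphism `ω'_M : M ⟶ M^{coH} ⊗ H`. -/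
def omega' : M.X ⟶ Q.obj ⊗ H := M.coact ≫ Q.π ▷ H

/-- The morphism `∇_M`, whose image is `M^{coH} × H`. -/
def nabla : Q.obj ⊗ H ⟶ Q.obj ⊗ H := Q.ι ▷ H ≫ M.act ≫ M.coact ≫ Q.π ▷ H

variable (T : IdempotentSplitting (M.nabla Q))

/-- The action of `H` on `M^{coH} × H`. -/
def prodAct : T.obj ⊗ H ⟶ T.obj :=
  T.ι ▷ H ≫ (α_ Q.obj H H).hom ≫ Q.obj ◁ mul[H] ≫ T.π

/-- The coaction of `H` on `M^{coH} × H`. -/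
def prodCoact : T.obj ⟶ T.obj ⊗ H :=
  T.ι ≫ Q.obj ◁ Δ[H] ≫ (α_ Q.obj H H).inv ≫ T.π ▷ H

/-- The action `φ_M^{α_M}` of `H` on `M` that defines quasilinearity, in the form
`φ_M ∘ (q_M ⊗ μ_H) ∘ (ρ_M ⊗ H)`. By `quasiAct_eq_transport` below it is the transport of the
action of `M^{coH} × H` along the isomorphism `α_M`, whatever splittings are chosen. -/
def quasiAct : M.X ⊗ H ⟶ M.X :=
  M.coact ▷ H ≫ (α_ M.X H H).hom ≫ (M.coinvMap ⊗ₘ mul[H]) ≫ M.act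

theorem coact_source_act : M.coact ≫ M.X ◁ sourceMap H ≫ M.act = 𝟙 M.X := by
  have h : M.X ◁ one[H] ≫ M.act ≫ M.coact ≫ M.X ◁ ε[H] ≫ (ρ_ M.X).hom = (ρ_ M.X).hom := by
    rw [M.isHopfModule.coact_counit, Category.comp_id, M.isHopfModule.act_one]
  rw [reassoc_of% M.isHopfModule.act_coact] at h
  have e : M.X ◁ one[H] ≫ (M.coact ⊗ₘ Δ[H]) ≫ tensorμ M.X H H H ≫ (M.act ⊗ₘ mul[H]) ≫
      M.X ◁ ε[H] ≫ (ρ_ M.X).hom =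
      (ρ_ M.X).hom ≫ M.coact ≫ M.X ◁ sourceMap H ≫ M.act := by
    rw [WeakHopfQuasigroup.source_eq, tensorμ, tensorHom_def M.coact, Category.assoc,
      whisker_exchange_assoc, tensorHom_def' M.act]
    simp only [Category.assoc]
    rw [← whisker_exchange_assoc M.act]
    simp
  rw [e] at h
  simpa using (ρ_ M.X).inv ≫= h

theorem coact_coinvMap_act : M.coact ≫ M.coinvMap ▷ H ≫ M.act = 𝟙 M.X := by
  rw [← M.coact_source_act, ← M.isHopfModule.act_antipode_act,
    ← reassoc_of% M.isHopfModule.coact_coact]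
  simp [coinvMap]

theorem omega'_omega : M.omega' Q ≫ M.omega Q = 𝟙 M.X := by
  rw [omega', omega, Category.assoc, ← comp_whiskerRight_assoc, Q.π_ι, coact_coinvMap_act]

theorem nabla_eq : M.nabla Q = M.omega Q ≫ M.omega' Q := by
  simp [nabla, omega, omega']

/-- The isomorphism `α_M : M ≅ M^{coH} × H`. -/
def alpha : M.X ≅ T.obj where
  hom := M.omega' Q ≫ T.π
  inv := T.ι ≫ M.omega Q
  hom_inv_id := by
    rw [Category.assoc, reassoc_of% T.π_ι, nabla_eq, Category.assoc, omega'_omega,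
      Category.comp_id, omega'_omega]
  inv_hom_id := by
    have h : T.ι ≫ M.nabla Q = T.ι := by
      have := T.ι ≫= T.π_ι
      rw [reassoc_of% T.ι_π] at this
      exact this.symm
    rw [Category.assoc, ← reassoc_of% M.nabla_eq Q, reassoc_of% h, T.ι_π]

/-- The action `quasiAct` is the transport of the action of `M^{coH} × H` along `α_M`. -/
theorem quasiAct_eq_transport :
    M.quasiAct = (M.alpha Q T).hom ▷ H ≫ M.prodAct Q T ≫ (M.alpha Q T).inv := by
  have h1 : M.omega' Q ≫ M.nabla Q = M.omega' Q := by
    rw [nabla_eq, reassoc_of% M.omega'_omega Q]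
  have h2 : M.nabla Q ≫ M.omega Q = M.omega Q := by
    rw [nabla_eq, Category.assoc, omega'_omega, Category.comp_id]
  simp only [alpha, prodAct, Category.assoc, comp_whiskerRight]
  rw [reassoc_of% T.π_ι, h2, ← comp_whiskerRight_assoc T.π, T.π_ι,
    ← comp_whiskerRight_assoc (M.omega' Q), h1]
  simp only [quasiAct, omega, omega', ← Q.π_ι, tensorHom_def', comp_whiskerRight, Category.assoc]
  simp [whisker_exchange_assoc]

/-- Morphisms of Hopf modules: `H`-colinear, `H`-quasilinear morphisms. -/
@[ext]
structure Hom (M N : HopfModule H) where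
  hom : M.X ⟶ N.X
  colinear : hom ≫ N.coact = M.coact ≫ hom ▷ H
  quasilinear : hom ▷ H ≫ N.quasiAct = M.quasiAct ≫ hom

/-- The category of right-right `H`-Hopf modules. -/
instance : Category (HopfModule H) where
  Hom M N := Hom M N
  id M := ⟨𝟙 M.X, by simp, by simp⟩
  comp f g := ⟨f.hom ≫ g.hom,
    by rw [Category.assoc, g.colinear, ← Category.assoc, f.colinear, Category.assoc,
      comp_whiskerRight],
    by rw [comp_whiskerRight, Category.assoc, g.quasilinear, ← Category.assoc, f.quasilinear,
      Category.assoc]⟩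
  id_comp _ := Hom.ext (Category.id_comp _)
  comp_id _ := Hom.ext (Category.comp_id _)
  assoc _ _ _ := Hom.ext (Category.assoc _ _ _)

variable (L : IdempotentSplitting (targetMap H))

/-- The Hopf module `M` is strong; here `L` is the image `H_L` of the target morphism. -/
def IsStrong : Prop :=
  (M.X ◁ L.ι) ▷ H ≫ M.act ▷ H ≫ M.act =
    (α_ M.X L.obj H).hom ≫ M.X ◁ (L.ι ▷ H ≫ mul[H]) ≫ M.act

/-- The action `ψ` of `H_L` on `M^{coH}`. -/
def coinvAct : Q.obj ⊗ L.obj ⟶ Q.obj := (Q.ι ⊗ₘ L.ι) ≫ M.act ≫ Q.π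

end HopfModule

section TensorOverTarget

variable {C : Type*} [Category C] [MonoidalCategory C] [BraidedCategory C]
variable {H : C} [WeakHopfQuasigroup H] (L : IdempotentSplitting (targetMap H))

/-- The unit of `H_L`. -/
def targetOne : 𝟙_ C ⟶ L.obj := one[H] ≫ L.π

/-- The product of `H_L`. -/
def targetMul : L.obj ⊗ L.obj ⟶ L.obj := (L.ι ⊗ₘ L.ι) ≫ mul[H] ≫ L.π

/-- The left action `φ_H = μ_H ∘ (i_L ⊗ H)` of `H_L` on `H`. -/
def targetLeftAct : L.obj ⊗ H ⟶ H := L.ι ▷ H ≫ mul[H]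

/-- `H_L` is a monoid. -/
structure IsTargetMonoid : Prop where
  one_mul : targetOne L ▷ L.obj ≫ targetMul L = (λ_ L.obj).hom
  mul_one : L.obj ◁ targetOne L ≫ targetMul L = (ρ_ L.obj).hom
  mul_assoc : targetMul L ▷ L.obj ≫ targetMul L =
    (α_ L.obj L.obj L.obj).hom ≫ L.obj ◁ targetMul L ≫ targetMul L

/-- `(N, ψ)` is a right `H_L`-module. -/
structure IsRightTargetModule {N : C} (ψ : N ⊗ L.obj ⟶ N) : Prop where
  act_one : N ◁ targetOne L ≫ ψ = (ρ_ N).hom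
  act_act : ψ ▷ L.obj ≫ ψ = (α_ N L.obj L.obj).hom ≫ N ◁ targetMul L ≫ ψ

variable [HasCoequalizers C] {N : C} (ψ : N ⊗ L.obj ⟶ N)

/-- The tensor product `N ⊗_{H_L} H` of a right `H_L`-module `(N, ψ)` with `H`. -/
noncomputable def tensorTarget : C :=
  coequalizer (ψ ▷ H) ((α_ N L.obj H).hom ≫ N ◁ targetLeftAct L)

/-- The projection `n_N : N ⊗ H ⟶ N ⊗_{H_L} H`. -/
noncomputable def tensorTargetπ : N ⊗ H ⟶ tensorTarget L ψ :=
  coequalizer.π (ψ ▷ H) ((α_ N L.obj H).hom ≫ N ◁ targetLeftAct L)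

/-- `(φ, ρ)` is the action and coaction of `H` on `N ⊗_{H_L} H` induced by the product and the
coproduct of `H`. -/
structure IsInduced (φ : tensorTarget L ψ ⊗ H ⟶ tensorTarget L ψ)
    (ρ : tensorTarget L ψ ⟶ tensorTarget L ψ ⊗ H) : Prop where
  act : tensorTargetπ L ψ ▷ H ≫ φ = (α_ N H H).hom ≫ N ◁ mul[H] ≫ tensorTargetπ L ψ
  coact : tensorTargetπ L ψ ≫ ρ = N ◁ Δ[H] ≫ (α_ N H H).inv ≫ tensorTargetπ L ψ ▷ H

end TensorOverTarget

/-! In element notation everything rests on ∇_M(m ⊗ h) = mΠᴸ(h₁) ⊗ h₂ for m in M^{coH}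
(`nabla_eq_coinvAct`). If t coequalizes the two actions of H_L, then t(∇_M(m ⊗ h)) = t(m ⊗ Πᴸ(h₁)h₂)
= t(m ⊗ h), because Πᴸ(h₁)h₂ = h (`target_mul`). So t factors through the projection p of ∇_M,
uniquely since p is split epi. Conversely p coequalizes: it factors through ω : m ⊗ h ↦ mh, which
coequalizes when M is strong. Hence p is a coequalizer, and comparison with the chosen one gives the
isomorphism s.

The formula for ∇_M comes from ρ(q(m)h) = q(m)h₁ ⊗ h₂ (`coinvMap_act_coact`). This also gives
q(q(m)h) = q(m)Πᴸ(h), so q is idempotent and M^{coH} is stable under H_L. Its proof uses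
`antipode_comul`, which stands in for anticomultiplicativity of the antipode, and Π̄ᴿ(h)k = ε(hk₁)k₂
(`barSource_mul`).

The product is not associative. Apart from the antipode axioms, products are reassociated only
around a factor in H_L: multiplication by such a factor can be written with ε and δ, and the weak
multiplicativity of ε does the rest (`mul_target_mul`, `target_mul_mul`).

Finally H, hence M^{coH} ⊗ H, is a Hopf module; the axioms descend along p and are then transported
along the comparison isomorphism. -/

namespace Ctx

/-! ### Calculus of morphisms acting at the head of a right-nested tensor product; the `_nat` lemmas
are the interchange law, oriented for `simp`. -/

section Monoidal

variable {C : Type*} [Category C] [MonoidalCategory C] {A B D E : C}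

/-- A morphism `A ⟶ B` acting on the first factor of `A ⊗ X`. -/
def en (f : A ⟶ B) (X : C) : A ⊗ X ⟶ B ⊗ X := f ▷ X

/-- A morphism `A ⊗ B ⟶ D` acting on the first two factors of `A ⊗ B ⊗ X`. -/
def bin (f : A ⊗ B ⟶ D) (X : C) : A ⊗ B ⊗ X ⟶ D ⊗ X := (α_ A B X).inv ≫ f ▷ X

/-- A morphism `A ⟶ B ⊗ D` acting on the first factor of `A ⊗ X`. -/
def cobin (f : A ⟶ B ⊗ D) (X : C) : A ⊗ X ⟶ B ⊗ D ⊗ X := f ▷ X ≫ (α_ B D X).hom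

/-- A morphism `A ⊗ B ⟶ D ⊗ E` acting on the first two factors of `A ⊗ B ⊗ X`. -/
def two (f : A ⊗ B ⟶ D ⊗ E) (X : C) : A ⊗ B ⊗ X ⟶ D ⊗ E ⊗ X :=
  (α_ A B X).inv ≫ f ▷ X ≫ (α_ D E X).hom

/-- A morphism `A ⟶ 𝟙_ C` acting on the first factor of `A ⊗ X`. -/
def del (f : A ⟶ 𝟙_ C) (X : C) : A ⊗ X ⟶ X := f ▷ X ≫ (λ_ X).hom

/-- A morphism `𝟙_ C ⟶ A` creating a first factor. -/
def ins (f : 𝟙_ C ⟶ A) (X : C) : X ⟶ A ⊗ X := (λ_ X).inv ≫ f ▷ X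

variable {X Y Z : C} (g : X ⟶ Y)

@[simp]
theorem bin_nat (f : A ⊗ B ⟶ D) : A ◁ B ◁ g ≫ bin f Y = bin f X ≫ D ◁ g := by
  simp [bin, ← whisker_exchange]

@[simp]
theorem bin_nat_assoc (f : A ⊗ B ⟶ D) (k : D ⊗ Y ⟶ Z) :
    A ◁ B ◁ g ≫ bin f Y ≫ k = bin f X ≫ D ◁ g ≫ k := by
  rw [reassoc_of% bin_nat]

@[simp]
theorem cobin_nat (f : A ⟶ B ⊗ D) : A ◁ g ≫ cobin f Y = cobin f X ≫ B ◁ D ◁ g := by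
  simp [cobin, whisker_exchange_assoc]

@[simp]
theorem cobin_nat_assoc (f : A ⟶ B ⊗ D) (k : B ⊗ D ⊗ Y ⟶ Z) :
    A ◁ g ≫ cobin f Y ≫ k = cobin f X ≫ B ◁ D ◁ g ≫ k := by
  rw [reassoc_of% cobin_nat]

@[simp]
theorem two_nat (f : A ⊗ B ⟶ D ⊗ E) : A ◁ B ◁ g ≫ two f Y = two f X ≫ D ◁ E ◁ g := by
  have h : (A ⊗ B) ◁ g ≫ f ▷ Y ≫ (α_ D E Y).hom = f ▷ X ≫ (α_ D E X).hom ≫ D ◁ E ◁ g := by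
    rw [whisker_exchange_assoc]; simp
  simpa [two] using (α_ A B X).inv ≫= h

@[simp]
theorem two_nat_assoc (f : A ⊗ B ⟶ D ⊗ E) (k : D ⊗ E ⊗ Y ⟶ Z) :
    A ◁ B ◁ g ≫ two f Y ≫ k = two f X ≫ D ◁ E ◁ g ≫ k := by
  rw [reassoc_of% two_nat]

@[simp]
theorem del_nat (f : A ⟶ 𝟙_ C) : A ◁ g ≫ del f Y = del f X ≫ g := by
  simp [del, whisker_exchange_assoc]

@[simp]
theorem del_nat_assoc (f : A ⟶ 𝟙_ C) (k : Y ⟶ Z) : A ◁ g ≫ del f Y ≫ k = del f X ≫ g ≫ k := by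
  rw [reassoc_of% del_nat]

@[simp]
theorem ins_nat (f : 𝟙_ C ⟶ A) : g ≫ ins f Y = ins f X ≫ A ◁ g := by
  simp [ins, ← whisker_exchange]

@[simp]
theorem ins_nat_assoc (f : 𝟙_ C ⟶ A) (k : A ⊗ Y ⟶ Z) :
    g ≫ ins f Y ≫ k = ins f X ≫ A ◁ g ≫ k := by
  rw [reassoc_of% ins_nat]

@[simp]
theorem en_nat (f : A ⟶ B) : A ◁ g ≫ en f Y = en f X ≫ B ◁ g := whisker_exchange f g

@[simp]
theorem en_nat_assoc (f : A ⟶ B) (k : B ⊗ Y ⟶ Z) :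
    A ◁ g ≫ en f Y ≫ k = en f X ≫ B ◁ g ≫ k := by
  rw [reassoc_of% en_nat]

theorem en_comp (f : A ⟶ B) (f' : B ⟶ D) (X : C) : en (f ≫ f') X = en f X ≫ en f' X := by
  simp [en]

/-- The unit object as tail recovers f itself; this is the way back from the calculus with tails to
plain equations. -/
theorem en_injective {f f' : A ⟶ B} (h : ∀ X, en f X = en f' X) : f = f' := by
  simpa [en] using h (𝟙_ C)

theorem bin_injective {f f' : A ⊗ B ⟶ D} (h : ∀ X, bin f X = bin f' X) : f = f' :=
  en_injective fun X => by simpa [bin, en] using h X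

/-- A commutative square whiskered on the left. -/
theorem whiskerLeft_square {P Q R S : C} {a : P ⟶ Q} {b : Q ⟶ R} {c : P ⟶ S} {d : S ⟶ R}
    (h : a ≫ b = c ≫ d) (A : C) : A ◁ a ≫ A ◁ b = A ◁ c ≫ A ◁ d := by
  rw [← whiskerLeft_comp, h, whiskerLeft_comp]

@[simp]
theorem whiskerLeft_bin_nat (V : C) (f : A ⊗ B ⟶ D) :
    V ◁ A ◁ B ◁ g ≫ V ◁ bin f Y = V ◁ bin f X ≫ V ◁ D ◁ g :=
  whiskerLeft_square (bin_nat g f) V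

@[simp]
theorem whiskerLeft_bin_nat_assoc (V : C) (f : A ⊗ B ⟶ D) (k : V ⊗ D ⊗ Y ⟶ Z) :
    V ◁ A ◁ B ◁ g ≫ V ◁ bin f Y ≫ k = V ◁ bin f X ≫ V ◁ D ◁ g ≫ k := by
  rw [reassoc_of% whiskerLeft_bin_nat g V f]

@[simp]
theorem whiskerLeft_cobin_nat (V : C) (f : A ⟶ B ⊗ D) :
    V ◁ A ◁ g ≫ V ◁ cobin f Y = V ◁ cobin f X ≫ V ◁ B ◁ D ◁ g :=
  whiskerLeft_square (cobin_nat g f) V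

@[simp]
theorem whiskerLeft_cobin_nat_assoc (V : C) (f : A ⟶ B ⊗ D) (k : V ⊗ B ⊗ D ⊗ Y ⟶ Z) :
    V ◁ A ◁ g ≫ V ◁ cobin f Y ≫ k = V ◁ cobin f X ≫ V ◁ B ◁ D ◁ g ≫ k := by
  rw [reassoc_of% whiskerLeft_cobin_nat g V f]

@[simp]
theorem whiskerLeft_two_nat (V : C) (f : A ⊗ B ⟶ D ⊗ E) :
    V ◁ A ◁ B ◁ g ≫ V ◁ two f Y = V ◁ two f X ≫ V ◁ D ◁ E ◁ g :=
  whiskerLeft_square (two_nat g f) V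

@[simp]
theorem whiskerLeft_two_nat_assoc (V : C) (f : A ⊗ B ⟶ D ⊗ E) (k : V ⊗ D ⊗ E ⊗ Y ⟶ Z) :
    V ◁ A ◁ B ◁ g ≫ V ◁ two f Y ≫ k = V ◁ two f X ≫ V ◁ D ◁ E ◁ g ≫ k := by
  rw [reassoc_of% whiskerLeft_two_nat g V f]

@[simp]
theorem whiskerLeft_del_nat (V : C) (f : A ⟶ 𝟙_ C) :
    V ◁ A ◁ g ≫ V ◁ del f Y = V ◁ del f X ≫ V ◁ g :=
  whiskerLeft_square (del_nat g f) V

@[simp]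
theorem whiskerLeft_del_nat_assoc (V : C) (f : A ⟶ 𝟙_ C) (k : V ⊗ Y ⟶ Z) :
    V ◁ A ◁ g ≫ V ◁ del f Y ≫ k = V ◁ del f X ≫ V ◁ g ≫ k := by
  rw [reassoc_of% whiskerLeft_del_nat g V f]

@[simp]
theorem whiskerLeft_en_nat (V : C) (f : A ⟶ B) :
    V ◁ A ◁ g ≫ V ◁ en f Y = V ◁ en f X ≫ V ◁ B ◁ g :=
  whiskerLeft_square (en_nat g f) V

@[simp]
theorem whiskerLeft_en_nat_assoc (V : C) (f : A ⟶ B) (k : V ⊗ B ⊗ Y ⟶ Z) :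
    V ◁ A ◁ g ≫ V ◁ en f Y ≫ k = V ◁ en f X ≫ V ◁ B ◁ g ≫ k := by
  rw [reassoc_of% whiskerLeft_en_nat g V f]

@[simp]
theorem whiskerLeft_whiskerLeft_bin_nat (V W : C) (f : A ⊗ B ⟶ D) :
    V ◁ W ◁ A ◁ B ◁ g ≫ V ◁ W ◁ bin f Y = V ◁ W ◁ bin f X ≫ V ◁ W ◁ D ◁ g :=
  whiskerLeft_square (whiskerLeft_bin_nat g W f) V

@[simp]
theorem whiskerLeft_whiskerLeft_bin_nat_assoc (V W : C) (f : A ⊗ B ⟶ D) (k : V ⊗ W ⊗ D ⊗ Y ⟶ Z) :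
    V ◁ W ◁ A ◁ B ◁ g ≫ V ◁ W ◁ bin f Y ≫ k = V ◁ W ◁ bin f X ≫ V ◁ W ◁ D ◁ g ≫ k := by
  rw [reassoc_of% whiskerLeft_whiskerLeft_bin_nat g V W f]

@[simp]
theorem whiskerLeft_whiskerLeft_cobin_nat (V W : C) (f : A ⟶ B ⊗ D) :
    V ◁ W ◁ A ◁ g ≫ V ◁ W ◁ cobin f Y = V ◁ W ◁ cobin f X ≫ V ◁ W ◁ B ◁ D ◁ g :=
  whiskerLeft_square (whiskerLeft_cobin_nat g W f) V

@[simp]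
theorem whiskerLeft_whiskerLeft_cobin_nat_assoc (V W : C) (f : A ⟶ B ⊗ D) (k : V ⊗ W ⊗ B ⊗ D ⊗ Y ⟶ Z) :
    V ◁ W ◁ A ◁ g ≫ V ◁ W ◁ cobin f Y ≫ k = V ◁ W ◁ cobin f X ≫ V ◁ W ◁ B ◁ D ◁ g ≫ k := by
  rw [reassoc_of% whiskerLeft_whiskerLeft_cobin_nat g V W f]

@[simp]
theorem whiskerLeft_whiskerLeft_two_nat (V W : C) (f : A ⊗ B ⟶ D ⊗ E) :
    V ◁ W ◁ A ◁ B ◁ g ≫ V ◁ W ◁ two f Y = V ◁ W ◁ two f X ≫ V ◁ W ◁ D ◁ E ◁ g :=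
  whiskerLeft_square (whiskerLeft_two_nat g W f) V

@[simp]
theorem whiskerLeft_whiskerLeft_two_nat_assoc (V W : C) (f : A ⊗ B ⟶ D ⊗ E) (k : V ⊗ W ⊗ D ⊗ E ⊗ Y ⟶ Z) :
    V ◁ W ◁ A ◁ B ◁ g ≫ V ◁ W ◁ two f Y ≫ k = V ◁ W ◁ two f X ≫ V ◁ W ◁ D ◁ E ◁ g ≫ k := by
  rw [reassoc_of% whiskerLeft_whiskerLeft_two_nat g V W f]

@[simp]
theorem whiskerLeft_whiskerLeft_del_nat (V W : C) (f : A ⟶ 𝟙_ C) :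
    V ◁ W ◁ A ◁ g ≫ V ◁ W ◁ del f Y = V ◁ W ◁ del f X ≫ V ◁ W ◁ g :=
  whiskerLeft_square (whiskerLeft_del_nat g W f) V

@[simp]
theorem whiskerLeft_whiskerLeft_del_nat_assoc (V W : C) (f : A ⟶ 𝟙_ C) (k : V ⊗ W ⊗ Y ⟶ Z) :
    V ◁ W ◁ A ◁ g ≫ V ◁ W ◁ del f Y ≫ k = V ◁ W ◁ del f X ≫ V ◁ W ◁ g ≫ k := by
  rw [reassoc_of% whiskerLeft_whiskerLeft_del_nat g V W f]

end Monoidal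

/-! ### Naturality and hexagons: sliding a strand across the elementary morphisms. -/

section Braided

variable {C : Type*} [Category C] [MonoidalCategory C] [BraidedCategory C]

variable {A B D E F X Z : C}

@[simp]
theorem br_bri : two (β_ A B).hom X ≫ two (β_ A B).inv X = 𝟙 _ := by simp [two]

@[simp]
theorem bri_br : two (β_ B A).inv X ≫ two (β_ B A).hom X = 𝟙 _ := by simp [two]

@[simp]
theorem bri_br_assoc (k : A ⊗ B ⊗ X ⟶ Z) : two (β_ B A).inv X ≫ two (β_ B A).hom X ≫ k = k := by
  rw [reassoc_of% bri_br]

theorem en_br (f : A ⟶ B) : en f (E ⊗ X) ≫ two (β_ B E).hom X = two (β_ A E).hom X ≫ E ◁ en f X := by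
  have h := congrArg (· ▷ X) (BraidedCategory.braiding_naturality_left f E)
  simp only [comp_whiskerRight] at h
  simp only [en, two, whiskerRight_tensor, Category.assoc, Iso.hom_inv_id_assoc]
  rw [reassoc_of% h]
  simp

theorem br_en (f : A ⟶ B) : E ◁ en f X ≫ two (β_ E B).hom X = two (β_ E A).hom X ≫ en f (E ⊗ X) := by
  have h := congrArg (· ▷ X) (BraidedCategory.braiding_naturality_right E f)
  simp only [comp_whiskerRight] at h
  simp only [en, two, whiskerRight_tensor, Category.assoc, Iso.hom_inv_id_assoc]
  rw [← reassoc_of% h]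
  simp

theorem associator_inv_br : (α_ A B (E ⊗ X)).inv ≫ two (β_ (A ⊗ B) E).hom X =
    A ◁ two (β_ B E).hom X ≫ two (β_ A E).hom (B ⊗ X) ≫ E ◁ (α_ A B X).inv := by
  simp only [two, BraidedCategory.braiding_tensor_left_hom]
  monoidal

theorem br_associator_inv : E ◁ (α_ A B X).inv ≫ two (β_ E (A ⊗ B)).hom X =
    two (β_ E A).hom (B ⊗ X) ≫ A ◁ two (β_ E B).hom X ≫ (α_ A B (E ⊗ X)).inv := by
  simp only [two, BraidedCategory.braiding_tensor_right_hom]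
  monoidal

theorem unitor_inv_br : (λ_ (E ⊗ X)).inv ≫ two (β_ (𝟙_ C) E).hom X = E ◁ (λ_ X).inv := by
  simp only [two, braiding_tensorUnit_left]
  monoidal

theorem br_unitor_inv : E ◁ (λ_ X).inv ≫ two (β_ E (𝟙_ C)).hom X = (λ_ (E ⊗ X)).inv := by
  simp only [two, braiding_tensorUnit_right]
  monoidal

theorem bin_br (f : A ⊗ B ⟶ D) :
    bin f (E ⊗ X) ≫ two (β_ D E).hom X = A ◁ two (β_ B E).hom X ≫ two (β_ A E).hom (B ⊗ X) ≫ E ◁ bin f X := by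
  have h := en_br (E := E) (X := X) f
  simp only [en] at h
  rw [bin, Category.assoc, h, reassoc_of% associator_inv_br, bin, whiskerLeft_comp]

theorem br_bin (f : A ⊗ B ⟶ D) :
    E ◁ bin f X ≫ two (β_ E D).hom X = two (β_ E A).hom (B ⊗ X) ≫ A ◁ two (β_ E B).hom X ≫ bin f (E ⊗ X) := by
  have h := br_en (E := E) (X := X) f
  simp only [en] at h
  rw [bin, whiskerLeft_comp, Category.assoc, h, reassoc_of% br_associator_inv, bin]

theorem cobin_br (f : A ⟶ B ⊗ D) :
    cobin f (E ⊗ X) ≫ B ◁ two (β_ D E).hom X ≫ two (β_ B E).hom (D ⊗ X) = two (β_ A E).hom X ≫ E ◁ cobin f X := by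
  have h := en_br (E := E) (X := X) f
  simp only [en] at h
  have h' := (α_ B D (E ⊗ X)).hom ≫= associator_inv_br (A := B) (B := D) (E := E) (X := X)
  rw [Iso.hom_inv_id_assoc] at h'
  rw [cobin, cobin, whiskerLeft_comp, ← reassoc_of% h, h']
  simp

theorem br_cobin (f : A ⟶ B ⊗ D) :
    E ◁ cobin f X ≫ two (β_ E B).hom (D ⊗ X) ≫ B ◁ two (β_ E D).hom X = two (β_ E A).hom X ≫ cobin f (E ⊗ X) := by
  have h := br_en (E := E) (X := X) f
  simp only [en] at h
  have h' := E ◁ (α_ B D X).hom ≫=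
    (br_associator_inv (A := B) (B := D) (E := E) (X := X)) =≫ (α_ B D (E ⊗ X)).hom
  rw [Category.assoc, whiskerLeft_hom_inv_assoc, Category.assoc, Category.assoc, Iso.inv_hom_id,
    Category.comp_id] at h'
  rw [cobin, cobin, whiskerLeft_comp, ← reassoc_of% h, h']
  simp

theorem ins_br (f : 𝟙_ C ⟶ A) : ins f (E ⊗ X) ≫ two (β_ A E).hom X = E ◁ ins f X := by
  have h := en_br (E := E) (X := X) f
  simp only [en] at h
  rw [ins, Category.assoc, h, reassoc_of% unitor_inv_br, ins, whiskerLeft_comp]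

theorem br_del (f : A ⟶ 𝟙_ C) : two (β_ A E).hom X ≫ E ◁ del f X = del f (E ⊗ X) := by
  have h := en_br (E := E) (X := X) f
  simp only [en] at h
  have h' := (λ_ (E ⊗ X)).hom ≫= unitor_inv_br (E := E) (X := X)
  rw [Iso.hom_inv_id_assoc] at h'
  rw [del, del, whiskerLeft_comp, ← reassoc_of% h, h']
  simp

theorem del_br (f : A ⟶ 𝟙_ C) : two (β_ E A).hom X ≫ del f (E ⊗ X) = E ◁ del f X := by
  have h := br_en (E := E) (X := X) f
  simp only [en] at h
  have h' := E ◁ (λ_ X).hom ≫= br_unitor_inv (E := E) (X := X) =≫ (λ_ (E ⊗ X)).hom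
  rw [Category.assoc, whiskerLeft_hom_inv_assoc, Iso.inv_hom_id, Category.comp_id] at h'
  rw [del, del, whiskerLeft_comp, ← reassoc_of% h, h']

theorem br_two (f : A ⊗ B ⟶ D ⊗ F) :
    E ◁ two f X ≫ two (β_ E D).hom (F ⊗ X) ≫ D ◁ two (β_ E F).hom X =
      two (β_ E A).hom (B ⊗ X) ≫ A ◁ two (β_ E B).hom X ≫ two f (E ⊗ X) := by
  have h := br_bin (E := E) (X := X) f
  have h' := E ◁ (α_ D F X).hom ≫=
    (br_associator_inv (A := D) (B := F) (E := E) (X := X)) =≫ (α_ D F (E ⊗ X)).hom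
  rw [Category.assoc, whiskerLeft_hom_inv_assoc, Category.assoc, Category.assoc, Iso.inv_hom_id,
    Category.comp_id] at h'
  have h2 : ∀ Y, two f Y = bin f Y ≫ (α_ D F Y).hom := fun Y => by simp [two, bin]
  rw [h2, h2, whiskerLeft_comp, Category.assoc, ← h', reassoc_of% h]

end Braided
end Ctx

/-! ### The axioms of a weak Hopf quasigroup, with an arbitrary tail. -/

namespace Ctx

section Axioms

variable {C : Type*} [Category C] [MonoidalCategory C] [BraidedCategory C]
variable {H : C} [WeakHopfQuasigroup H]

local notation "mH" => bin (UnitalMagmaObj.mul (X := H))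
local notation "uH" => ins (UnitalMagmaObj.one (X := H))
local notation "dH" => cobin (ComonObj.comul (X := H))
local notation "eH" => del (ComonObj.counit (X := H))
local notation "cH" => two (Iso.hom (BraidedCategory.braiding H H))
local notation "ciH" => two (Iso.inv (BraidedCategory.braiding H H))
local notation "lH" => en (WeakHopfQuasigroupData.antipode (H := H))
local notation "tH" => en (targetMap H)
local notation "sH" => en (sourceMap H)

variable (X : C)

theorem ins_one_bin_mul : uH (H ⊗ X) ≫ mH X = 𝟙 _ := by
  have h := congrArg (· ▷ X) (UnitalMagmaObj.one_mul (X := H))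
  simp only [comp_whiskerRight] at h
  have : uH (H ⊗ X) ≫ mH X = (λ_ (H ⊗ X)).inv ≫ (α_ _ _ _).inv ≫
    (UnitalMagmaObj.one (X := H) ▷ H) ▷ X ≫ UnitalMagmaObj.mul (X := H) ▷ X := by
    simp only [ins, bin]; monoidal
  rw [this, h]; monoidal

theorem whiskerLeft_ins_one_bin_mul : H ◁ uH X ≫ mH X = 𝟙 _ := by
  have h := congrArg (· ▷ X) (UnitalMagmaObj.mul_one (X := H))
  simp only [comp_whiskerRight] at h
  have : H ◁ uH X ≫ mH X = H ◁ (λ_ X).inv ≫ (α_ _ _ _).inv ≫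
    (H ◁ UnitalMagmaObj.one (X := H)) ▷ X ≫ UnitalMagmaObj.mul (X := H) ▷ X := by
    simp only [ins, bin]; monoidal
  rw [this, h]; monoidal

theorem comul_counit : dH X ≫ eH (H ⊗ X) = 𝟙 _ := by
  have h := congrArg (· ▷ X) (ComonObj.counit_comul (X := H))
  simp only [comp_whiskerRight] at h
  have : dH X ≫ eH (H ⊗ X) = (Δ[H] ▷ X ≫ (ε[H] ▷ H) ▷ X) ≫ (λ_ H).hom ▷ X := by
    simp only [cobin, del]; monoidal
  rw [this, h]; monoidal

theorem comul_whiskerLeft_counit : dH X ≫ H ◁ eH X = 𝟙 _ := by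
  have h := congrArg (· ▷ X) (ComonObj.comul_counit (X := H))
  simp only [comp_whiskerRight] at h
  have : dH X ≫ H ◁ eH X = (Δ[H] ▷ X ≫ (H ◁ ε[H]) ▷ X) ≫ (ρ_ H).hom ▷ X := by
    simp only [cobin, del]; monoidal
  rw [this, h]; monoidal

theorem comul_comul : dH X ≫ dH (H ⊗ X) = dH X ≫ H ◁ dH X := by
  have h := congrArg (· ▷ X) (ComonObj.comul_assoc (X := H))
  simp only [comp_whiskerRight] at h
  have h1 : dH X ≫ dH (H ⊗ X) =
      (Δ[H] ▷ X ≫ (Δ[H] ▷ H) ▷ X ≫ (α_ H H H).hom ▷ X) ≫ (α_ H (H ⊗ H) X).hom ≫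
        H ◁ (α_ H H X).hom := by
    simp only [cobin]; monoidal
  have h2 : dH X ≫ H ◁ dH X = (Δ[H] ▷ X ≫ (H ◁ Δ[H]) ▷ X) ≫ (α_ H (H ⊗ H) X).hom ≫
        H ◁ (α_ H H X).hom := by
    simp only [cobin]; monoidal
  rw [h1, h2, h]

theorem mul_comul : mH X ≫ dH X =
    dH (H ⊗ X) ≫ H ◁ H ◁ dH X ≫ H ◁ cH (H ⊗ X) ≫ mH (H ⊗ H ⊗ X) ≫ H ◁ mH X := by
  have h := congrArg (· ▷ X) (WeakHopfQuasigroup.mul_comul (H := H))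
  simp only [comp_whiskerRight, MonoidalCategory.tensorHom_def, tensorμ] at h
  have h1 : mH X ≫ dH X = (α_ _ _ _).inv ≫ (mul[H] ▷ X ≫ Δ[H] ▷ X) ≫ (α_ _ _ _).hom := by
    simp only [cobin, bin]; monoidal
  rw [h1, h]
  simp only [cobin, bin, two]; monoidal

theorem counit_assoc : mH (H ⊗ X) ≫ mH X ≫ eH X = H ◁ mH X ≫ mH X ≫ eH X := by
  have h := congrArg (· ▷ X) (WeakHopfQuasigroup.counit_assoc (H := H))
  simp only [comp_whiskerRight] at h
  have h1 : mH (H ⊗ X) ≫ mH X ≫ eH X = (α_ _ _ _).inv ≫ (α_ _ _ _).inv ≫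
      ((mul[H] ▷ H) ▷ X ≫ mul[H] ▷ X ≫ ε[H] ▷ X) ≫ (λ_ _).hom := by
    simp only [bin, del]; monoidal
  rw [h1, h]
  simp only [bin, del]; monoidal

theorem counit_split : mH (H ⊗ X) ≫ mH X ≫ eH X =
    H ◁ dH (H ⊗ X) ≫ mH (H ⊗ H ⊗ X) ≫ eH (H ⊗ H ⊗ X) ≫ mH X ≫ eH X := by
  have h := congrArg (· ▷ X) (WeakHopfQuasigroup.counit_split (H := H))
  simp only [comp_whiskerRight, MonoidalCategory.tensorHom_def] at h
  have h1 : mH (H ⊗ X) ≫ mH X ≫ eH X = (α_ _ _ _).inv ≫ (α_ _ _ _).inv ≫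
      ((mul[H] ▷ H) ▷ X ≫ mul[H] ▷ X ≫ ε[H] ▷ X) ≫ (λ_ _).hom := by
    simp only [bin, del]; monoidal
  rw [h1, h]
  simp only [bin, del, cobin]; monoidal

theorem counit_split_bri : mH (H ⊗ X) ≫ mH X ≫ eH X =
    H ◁ dH (H ⊗ X) ≫ H ◁ ciH (H ⊗ X) ≫ mH (H ⊗ H ⊗ X) ≫ eH (H ⊗ H ⊗ X) ≫ mH X ≫ eH X := by
  have h := congrArg (· ▷ X) (WeakHopfQuasigroup.counit_split_braided (H := H))
  simp only [comp_whiskerRight, MonoidalCategory.tensorHom_def] at h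
  have h1 : mH (H ⊗ X) ≫ mH X ≫ eH X = (α_ _ _ _).inv ≫ (α_ _ _ _).inv ≫
      ((mul[H] ▷ H) ▷ X ≫ mul[H] ▷ X ≫ ε[H] ▷ X) ≫ (λ_ _).hom := by
    simp only [bin, del]; monoidal
  rw [h1, h]
  simp only [bin, del, cobin, two]; monoidal

theorem unit_split : uH X ≫ dH X ≫ dH (H ⊗ X) =
    uH X ≫ dH X ≫ H ◁ H ◁ uH X ≫ H ◁ H ◁ dH X ≫ H ◁ mH (H ⊗ X) := by
  have h := congrArg (· ▷ X) (WeakHopfQuasigroup.unit_split (H := H))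
  simp only [comp_whiskerRight, MonoidalCategory.tensorHom_def] at h
  have h1 : uH X ≫ dH X ≫ dH (H ⊗ X) = (λ_ _).inv ≫
      (one[H] ▷ X ≫ Δ[H] ▷ X ≫ (Δ[H] ▷ H) ▷ X) ≫ (α_ _ _ _).hom ≫ (α_ _ _ _).hom := by
    simp only [ins, cobin]; monoidal
  rw [h1, h]
  simp only [bin, ins, cobin]; monoidal

theorem unit_split_bri : uH X ≫ dH X ≫ dH (H ⊗ X) =
    uH X ≫ dH X ≫ H ◁ H ◁ uH X ≫ H ◁ H ◁ dH X ≫ H ◁ ciH (H ⊗ X) ≫ H ◁ mH (H ⊗ X) := by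
  have h := congrArg (· ▷ X) (WeakHopfQuasigroup.unit_split_braided (H := H))
  simp only [comp_whiskerRight, MonoidalCategory.tensorHom_def] at h
  have h1 : uH X ≫ dH X ≫ dH (H ⊗ X) = (λ_ _).inv ≫
      (one[H] ▷ X ≫ Δ[H] ▷ X ≫ (Δ[H] ▷ H) ▷ X) ≫ (α_ _ _ _).hom ≫ (α_ _ _ _).hom := by
    simp only [ins, cobin]; monoidal
  rw [h1, h]
  simp only [bin, ins, cobin, two]; monoidal

theorem convolution_eq (f g : H ⟶ H) :
    en (convolution f g) X = dH X ≫ H ◁ en g X ≫ en f (H ⊗ X) ≫ mH X := by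
  simp only [convolution, en, cobin, bin, MonoidalCategory.tensorHom_def']; monoidal

theorem target_eq : tH X =
    uH (H ⊗ X) ≫ dH (H ⊗ X) ≫ H ◁ cH X ≫ mH (H ⊗ X) ≫ eH (H ⊗ X) := by
  rw [WeakHopfQuasigroup.target_eq]
  simp only [en, cobin, bin, ins, del, two]; monoidal

theorem source_eq : sH X =
    H ◁ uH X ≫ H ◁ dH X ≫ cH (H ⊗ X) ≫ H ◁ mH X ≫ H ◁ eH X := by
  rw [WeakHopfQuasigroup.source_eq]
  simp only [en, cobin, bin, ins, del, two]; monoidal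

theorem antipode_mul_mul :
    dH (H ⊗ X) ≫ lH (H ⊗ H ⊗ X) ≫ H ◁ mH X ≫ mH X = sH (H ⊗ X) ≫ mH X := by
  have h := congrArg (· ▷ X) (WeakHopfQuasigroup.antipode_mul_mul (H := H))
  simp only [comp_whiskerRight, MonoidalCategory.tensorHom_def] at h
  have h1 : sH (H ⊗ X) ≫ mH X = (α_ _ _ _).inv ≫ (sourceMap H ▷ H) ▷ X ≫ mul[H] ▷ X := by
    simp only [en, bin]; monoidal
  rw [h1, ← h]
  simp only [en, bin, cobin]; monoidal

theorem mul_mul_antipode :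
    H ◁ dH X ≫ mH (H ⊗ X) ≫ H ◁ lH X ≫ mH X = H ◁ tH X ≫ mH X := by
  have h := congrArg (· ▷ X) (WeakHopfQuasigroup.mul_mul_antipode (H := H))
  simp only [comp_whiskerRight, MonoidalCategory.tensorHom_def] at h
  have h1 : H ◁ tH X ≫ mH X = (α_ _ _ _).inv ≫ (H ◁ targetMap H) ▷ X ≫ mul[H] ▷ X := by
    simp only [en, bin]; monoidal
  rw [h1, ← h]
  simp only [en, bin, cobin]; monoidal

end Axioms
end Ctx

/-! ### The counital morphisms Πᴸ, Πᴿ, Π̄ᴿ and multiplication by their values. -/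

/-- The morphism `Π̄ᴿ`, in elements `h ↦ ε(h 1₁) 1₂`. -/
def barSourceMap {C : Type*} [Category C] [MonoidalCategory C] (H : C)
    [WeakHopfQuasigroupData H] : H ⟶ H :=
  (ρ_ H).inv ≫ H ◁ (one[H] ≫ Δ[H]) ≫ (α_ H H H).inv ≫ (mul[H] ≫ ε[H]) ▷ H ≫ (λ_ H).hom

namespace Ctx

section Target

variable {C : Type*} [Category C] [MonoidalCategory C] [BraidedCategory C]
variable {H : C} [WeakHopfQuasigroup H]

local notation "mH" => bin (UnitalMagmaObj.mul (X := H))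
local notation "uH" => ins (UnitalMagmaObj.one (X := H))
local notation "dH" => cobin (ComonObj.comul (X := H))
local notation "eH" => del (ComonObj.counit (X := H))
local notation "cH" => two (Iso.hom (BraidedCategory.braiding H H))
local notation "ciH" => two (Iso.inv (BraidedCategory.braiding H H))
local notation "tH" => en (targetMap H)
local notation "sH" => en (sourceMap H)
local notation "bH" => en (barSourceMap H)

variable (X : C)

theorem barSource_eq : bH X = H ◁ uH X ≫ H ◁ dH X ≫ mH (H ⊗ X) ≫ eH (H ⊗ X) := by
  simp only [barSourceMap, en, cobin, bin, ins, del]; monoidal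

/-- `h k = ε(h₁ k₁) h₂ k₂`. -/
theorem mul_eq_left : mH X = dH (H ⊗ X) ≫ H ◁ H ◁ dH X ≫ H ◁ cH (H ⊗ X) ≫
    mH (H ⊗ H ⊗ X) ≫ eH (H ⊗ H ⊗ X) ≫ mH X := by
  simpa [comul_counit] using mul_comul X =≫ eH (H ⊗ X)

/-- `h k = h₁ k₁ ε(h₂ k₂)`. -/
theorem mul_eq_right : mH X = dH (H ⊗ X) ≫ H ◁ H ◁ dH X ≫ H ◁ cH (H ⊗ X) ≫
    mH (H ⊗ H ⊗ X) ≫ H ◁ mH X ≫ H ◁ eH X := by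
  simpa [comul_whiskerLeft_counit] using mul_comul X =≫ H ◁ eH X

/-- A strand slides across δ(1) by naturality of the braiding. This trades the inverse braiding of
the unit axiom for the braiding that occurs in Πᴸ. -/
theorem unit_bri : H ◁ uH X ≫ H ◁ dH X ≫ ciH (H ⊗ X) =
    uH (H ⊗ X) ≫ dH (H ⊗ X) ≫ H ◁ cH X := by
  have h1 := ins_br (E := H) (X := X) (UnitalMagmaObj.one (X := H))
  have h2 := cobin_br (E := H) (X := X) (ComonObj.comul (X := H))
  rw [← reassoc_of% h1, ← reassoc_of% h2, br_bri, Category.comp_id]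

theorem counit_bri : H ◁ ciH X ≫ mH (H ⊗ X) ≫ eH (H ⊗ X) =
    cH (H ⊗ X) ≫ H ◁ mH X ≫ H ◁ eH X := by
  have h1 := br_del (E := H) (X := X) (ComonObj.counit (X := H))
  have h2 := bin_br (E := H) (X := X) (UnitalMagmaObj.mul (X := H))
  rw [← h1, reassoc_of% h2, ← whiskerLeft_comp_assoc, bri_br]
  simp

theorem unit_split_br : uH X ≫ dH X ≫ dH (H ⊗ X) =
    uH X ≫ dH X ≫ H ◁ uH (H ⊗ X) ≫ H ◁ dH (H ⊗ X) ≫ H ◁ H ◁ cH X ≫ H ◁ mH (H ⊗ X) := by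
  have h := congrArg (H ◁ ·) (unit_bri (H := H) X)
  simp only [whiskerLeft_comp] at h
  rw [unit_split_bri, reassoc_of% h]

theorem counit_split_br : mH (H ⊗ X) ≫ mH X ≫ eH X =
    H ◁ dH (H ⊗ X) ≫ cH (H ⊗ H ⊗ X) ≫ H ◁ mH (H ⊗ X) ≫ H ◁ eH (H ⊗ X) ≫ mH X ≫ eH X := by
  have h := counit_bri (H := H) (H ⊗ X)
  rw [counit_split_bri, reassoc_of% h]

/-- Apply ε to the middle leg of (δ ⊗ H)δ(1) = 1₁ ⊗ 1₂1′₁ ⊗ 1′₂. The braided form of the axiom gives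
`unit_target` in the same way. -/
theorem unit_barSource : uH X ≫ dH X ≫ H ◁ bH X = uH X ≫ dH X := by
  have h := (unit_split (H := H) X) =≫ H ◁ eH (H ⊗ X)
  simp only [Category.assoc, comul_whiskerLeft_counit, Category.comp_id] at h
  rw [h, barSource_eq]
  simp

theorem unit_target : uH X ≫ dH X ≫ H ◁ tH X = uH X ≫ dH X := by
  have h := (unit_split_br (H := H) X) =≫ H ◁ eH (H ⊗ X)
  simp only [Category.assoc, comul_whiskerLeft_counit, Category.comp_id] at h
  rw [h, target_eq]
  simp

/-- Πᴸ(h) = ε(1₁h)1₂ takes its value in the second leg of δ(1), so whatever fixes that leg fixes the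
image of Πᴸ. -/
theorem target_comp_of_unit (f : H ⟶ H) (hf : ∀ X, uH X ≫ dH X ≫ H ◁ en f X = uH X ≫ dH X) :
    tH X ≫ en f X = tH X := by
  have h := whiskerLeft_square (en_br (E := H) (X := X) f) H
  calc tH X ≫ en f X = uH (H ⊗ X) ≫ dH (H ⊗ X) ≫ (H ◁ cH X ≫ H ◁ H ◁ en f X) ≫
        mH (H ⊗ X) ≫ eH (H ⊗ X) := by rw [target_eq]; simp
    _ = (uH (H ⊗ X) ≫ dH (H ⊗ X) ≫ H ◁ en f (H ⊗ X)) ≫ H ◁ cH X ≫ mH (H ⊗ X) ≫ eH (H ⊗ X) := by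
        rw [← h]; simp only [Category.assoc]
    _ = tH X := by rw [hf, target_eq]; simp only [Category.assoc]

theorem target_barSource : tH X ≫ bH X = tH X := target_comp_of_unit X _ unit_barSource

theorem target_target : tH X ≫ tH X = tH X := target_comp_of_unit X _ unit_target

theorem one_target : uH X ≫ tH X = uH X := by
  simpa [comul_counit, reassoc_of% comul_counit (H := H)] using
    unit_target (H := H) X =≫ eH (H ⊗ X)

/-- `Πᴸ(h₁) h₂ = h`. -/
theorem target_mul : dH X ≫ tH (H ⊗ X) ≫ mH X = 𝟙 _ := by
  have h := uH (H ⊗ X) ≫= mul_eq_left (H := H) X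
  rw [ins_one_bin_mul] at h
  rw [h, target_eq]
  simp

/-- `Π̄ᴿ(h) k = ε(h k₁) k₂`. -/
theorem barSource_mul : bH (H ⊗ X) ≫ mH X = H ◁ dH X ≫ mH (H ⊗ X) ≫ eH (H ⊗ X) := by
  rw [mul_eq_left X]
  have h := uH (H ⊗ X) ≫= mul_comul (H := H) X
  rw [reassoc_of% ins_one_bin_mul (H := H) X] at h
  have h' := congrArg (H ◁ ·) h
  have cc' := whiskerLeft_square (comul_comul (H := H) (H ⊗ X)) H
  simp only [whiskerLeft_comp] at h'
  -- On the right, δ(k) = δ(1k) = 1₁k₁ ⊗ 1₂k₂; then ε(h(1₁k₁)) splits as ε(h1₁)ε(1₂k₁), and both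
  -- sides agree.
  nth_rw 2 [h']
  simp only [Category.assoc, bin_nat_assoc, del_nat]
  rw [← reassoc_of% counit_assoc (H := H), reassoc_of% counit_split (H := H), barSource_eq]
  simp
  rw [reassoc_of% cc']
  simp

theorem barSource_mul_comul : bH (H ⊗ X) ≫ mH X ≫ dH X =
    H ◁ dH X ≫ bH (H ⊗ H ⊗ X) ≫ mH (H ⊗ X) := by
  have h := whiskerLeft_square (comul_comul (H := H) X) H
  rw [reassoc_of% barSource_mul (H := H) X, barSource_mul]
  simp [reassoc_of% h]

/-- `δ(a k) = a k₁ ⊗ k₂` for `a = Πᴸ(h)`. -/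
theorem target_mul_comul : tH (H ⊗ X) ≫ mH X ≫ dH X =
    H ◁ dH X ≫ tH (H ⊗ H ⊗ X) ≫ mH (H ⊗ X) := by
  rw [← target_barSource, Category.assoc, barSource_mul_comul]
  simp [reassoc_of% target_barSource (H := H)]

theorem target_comul : tH X ≫ dH X = H ◁ uH X ≫ H ◁ dH X ≫ tH (H ⊗ H ⊗ X) ≫ mH (H ⊗ X) := by
  have h := H ◁ uH X ≫= target_mul_comul (H := H) X
  simp at h
  simpa [reassoc_of% whiskerLeft_ins_one_bin_mul (H := H)] using h

theorem whiskerLeft_counit_mul : H ◁ mH X ≫ H ◁ eH X =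
    cH (H ⊗ X) ≫ H ◁ cH X ≫ mH (H ⊗ X) ≫ eH (H ⊗ X) := by
  have h1 := br_bin (E := H) (X := X) (UnitalMagmaObj.mul (X := H))
  have h2 := del_br (E := H) (X := X) (ComonObj.counit (X := H))
  rw [← h2, reassoc_of% h1]

/-- ε((hk)l) = ε(k₁l)ε(hk₂), with the inverse braiding of the axiom replaced by braiding k₂ past l.
-/
theorem counit_split_mid : mH (H ⊗ X) ≫ mH X ≫ eH X =
    H ◁ dH (H ⊗ X) ≫ H ◁ H ◁ cH X ≫ H ◁ mH (H ⊗ X) ≫ H ◁ eH (H ⊗ X) ≫ mH X ≫ eH X := by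
  have h := ciH (H ⊗ X) ≫= whiskerLeft_counit_mul (H := H) X
  simp only [bri_br_assoc] at h
  have h' := congrArg (H ◁ ·) h
  simp only [whiskerLeft_comp] at h'
  rw [← reassoc_of% h', counit_split_bri]
  simp

/-- `h Πᴸ(k) = ε(h₁ k) h₂`. -/
theorem whiskerLeft_target_mul : H ◁ tH X ≫ mH X =
    dH (H ⊗ X) ≫ H ◁ cH X ≫ mH (H ⊗ X) ≫ eH (H ⊗ X) := by
  have h1 := H ◁ uH (H ⊗ X) ≫= mul_comul (H := H) (H ⊗ X)
  rw [reassoc_of% whiskerLeft_ins_one_bin_mul (H := H)] at h1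
  have h2 := whiskerLeft_square (bin_br (E := H) (X := X) (UnitalMagmaObj.mul (X := H))) H
  simp only [whiskerLeft_comp] at h2
  have h3 := whiskerLeft_square (whiskerLeft_counit_mul (H := H) (H ⊗ H ⊗ X)) H
  have h4 := whiskerLeft_square (br_cobin (E := H) (X := H ⊗ H ⊗ X) (ComonObj.comul (X := H))) H
  have h5 := whiskerLeft_square (whiskerLeft_square (br_two (E := H) (X := H ⊗ X) (β_ H H).hom) H) H
  have h6 := whiskerLeft_square (whiskerLeft_square (comul_comul (H := H) (H ⊗ X)) H) H
  have h7 := whiskerLeft_square (whiskerLeft_square (whiskerLeft_square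
    (cobin_br (E := H) (X := X) (ComonObj.comul (X := H))) H) H) H
  simp only [whiskerLeft_comp] at h3 h4 h5 h7
  -- With δ(h) = δ(h1), the right side is ε((h₁1₁)k)h₂1₂ and the left side ε(1₁k)ε(h₁1₂)h₂1₃;
  -- `counit_split_mid` matches them.
  rw [h1, target_eq, mul_eq_left X]
  simp [reassoc_of% h2]
  rw [← bin_nat_assoc (H ◁ cH X), ← bin_nat_assoc (cH (H ⊗ X)),
    reassoc_of% counit_split_mid (H := H), ← whiskerLeft_whiskerLeft_del_nat_assoc (dH X),
    ← whiskerLeft_whiskerLeft_bin_nat_assoc (dH X), reassoc_of% h3, ← reassoc_of% h7]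
  simp
  rw [← reassoc_of% h4, reassoc_of% h6]
  simp
  rw [← whiskerLeft_whiskerLeft_two_nat_assoc (cH X), ← reassoc_of% h5]
  simp

theorem counit_mul_br : mH (H ⊗ X) ≫ eH (H ⊗ X) =
    H ◁ cH X ≫ cH (H ⊗ X) ≫ H ◁ mH X ≫ H ◁ eH X := by
  have h1 := bin_br (E := H) (X := X) (UnitalMagmaObj.mul (X := H))
  have h2 := br_del (E := H) (X := X) (ComonObj.counit (X := H))
  rw [← h2, reassoc_of% h1]

/-- `Πᴿ(h) k = k₁ ε(h k₂)`. -/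
theorem source_mul : sH (H ⊗ X) ≫ mH X =
    H ◁ dH X ≫ cH (H ⊗ X) ≫ H ◁ mH X ≫ H ◁ eH X := by
  have h1 := uH (H ⊗ X) ≫= mul_comul (H := H) X
  rw [reassoc_of% ins_one_bin_mul (H := H) X] at h1
  have h2 := congrArg (H ◁ ·) h1
  have h3 := br_bin (E := H) (X := H ⊗ H ⊗ X) (UnitalMagmaObj.mul (X := H))
  have h4 := whiskerLeft_square (counit_assoc (H := H) X) H
  have h5 := whiskerLeft_square (counit_split_br (H := H) X) H
  simp only [whiskerLeft_comp] at h2 h4 h5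
  conv_lhs => rw [source_eq, mul_eq_right X]
  conv_rhs => rw [h2]
  simp [reassoc_of% h3]
  rw [← h4, h5]
  have h6 := whiskerLeft_square (whiskerLeft_square
    (cobin_br (E := H) (X := H ⊗ X) (ComonObj.comul (X := H))) H) H
  have h7 := whiskerLeft_square (br_two (E := H) (X := H ⊗ H ⊗ X) (β_ H H).hom) H
  have h8 := whiskerLeft_square (whiskerLeft_square (counit_mul_br (H := H) (H ⊗ X)) H) H
  have h9 := br_cobin (E := H) (X := H ⊗ H ⊗ X) (ComonObj.comul (X := H))
  have h10 := whiskerLeft_square (comul_comul (H := H) (H ⊗ X)) H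
  simp only [whiskerLeft_comp] at h6 h7 h8
  rw [← bin_nat_assoc (H ◁ dH (H ⊗ X)), ← bin_nat_assoc (cH (H ⊗ H ⊗ X)),
    ← whiskerLeft_two_nat_assoc (dH (H ⊗ X)), ← reassoc_of% h6, reassoc_of% h7,
    ← whiskerLeft_whiskerLeft_del_nat_assoc (dH X),
    ← whiskerLeft_whiskerLeft_bin_nat_assoc (dH X), reassoc_of% h8, ← reassoc_of% h9,
    reassoc_of% h10]
  simp

end Target
end Ctx

/-! ### Associativity around H_L, and the coproduct of the antipode. -/

namespace Ctx

section Associativity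

variable {C : Type*} [Category C] [MonoidalCategory C] [BraidedCategory C]
variable {H : C} [WeakHopfQuasigroup H]

local notation "mH" => bin (UnitalMagmaObj.mul (X := H))
local notation "uH" => ins (UnitalMagmaObj.one (X := H))
local notation "dH" => cobin (ComonObj.comul (X := H))
local notation "cH" => two (Iso.hom (BraidedCategory.braiding H H))
local notation "lH" => en (WeakHopfQuasigroupData.antipode (H := H))
local notation "tH" => en (targetMap H)
local notation "bH" => en (barSourceMap H)

variable (X : C)

/-- `(h a) k = h (a k)` for `a = Πᴸ(x)`. -/
theorem mul_target_mul : H ◁ tH (H ⊗ X) ≫ mH (H ⊗ X) ≫ mH X =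
    H ◁ tH (H ⊗ X) ≫ H ◁ mH X ≫ mH X := by
  have h1 := whiskerLeft_square (whiskerLeft_square (target_mul_comul (H := H) X) H) H
  have h2 := whiskerLeft_square (br_bin (E := H) (X := H ⊗ X) (UnitalMagmaObj.mul (X := H))) H
  have h3 := whiskerLeft_square (br_en (E := H) (X := H ⊗ H ⊗ X) (targetMap H)) H
  have h4 := counit_assoc (H := H) (H ⊗ H ⊗ X)
  have h5 := whiskerLeft_square (cobin_br (E := H) (X := H ⊗ X) (ComonObj.comul (X := H))) H
  simp only [whiskerLeft_comp] at h1 h2 h5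
  -- The left side is ε(h₁x)h₂k. On the right, δ(ak) = ak₁ ⊗ k₂ gives ε(h₁(ak₁))h₂k₂ =
  -- ε((h₁a)k₁)h₂k₂, which reduces to the same.
  rw [reassoc_of% whiskerLeft_target_mul (H := H) (H ⊗ X)]
  conv_rhs => enter [2, 2]; rw [mul_eq_left X]
  conv_lhs => enter [2, 2, 2, 2]; rw [mul_eq_left X]
  simp
  rw [reassoc_of% h1, reassoc_of% h2, reassoc_of% h3, ← reassoc_of% h4,
    bin_nat_assoc (cH (H ⊗ X)), reassoc_of% whiskerLeft_target_mul (H := H)]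
  simp [reassoc_of% comul_comul (H := H), reassoc_of% h5]

/-- `(a h) k = a (h k)` for `a = Πᴸ(x)`. -/
theorem target_mul_mul : tH (H ⊗ H ⊗ X) ≫ mH (H ⊗ X) ≫ mH X =
    tH (H ⊗ H ⊗ X) ≫ H ◁ mH X ≫ mH X := by
  -- The identity holds already for Π̄ᴿ(x) in place of a: both sides are ε(xh₁)h₂k. It applies to a
  -- because Π̄ᴿ ∘ Πᴸ = Πᴸ.
  have h1 : bH (H ⊗ H ⊗ X) ≫ mH (H ⊗ X) ≫ mH X = bH (H ⊗ H ⊗ X) ≫ H ◁ mH X ≫ mH X := by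
    have h2 := congrArg (H ◁ ·) (mul_comul (H := H) X)
    have h4 := counit_assoc (H := H) (H ⊗ H ⊗ X)
    simp only [whiskerLeft_comp] at h2
    rw [reassoc_of% barSource_mul (H := H) (H ⊗ X), ← en_nat_assoc (mH X), barSource_mul,
      reassoc_of% h2]
    conv_lhs => enter [2, 2, 2]; rw [mul_eq_left X]
    simp
    rw [← reassoc_of% h4, reassoc_of% counit_split (H := H)]
    have h3 := whiskerLeft_square (comul_comul (H := H) (H ⊗ X)) H
    simp [reassoc_of% h3]
  rw [← target_barSource, Category.assoc, h1]
  simp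

/-- `Πᴸ(a h) = a Πᴸ(h)` for `a = Πᴸ(x)`. -/
theorem target_mul_target : tH (H ⊗ X) ≫ mH X ≫ tH X = tH (H ⊗ X) ≫ H ◁ tH X ≫ mH X := by
  have h1 : tH X = dH X ≫ H ◁ lH X ≫ mH X := by
    rw [targetMap, convolution_eq]; simp [en]
  conv_lhs => rw [h1, reassoc_of% target_mul_comul (H := H) X]
  simp
  rw [← mul_mul_antipode]

/-- `λ(h₂)₁ ⊗ h₁ λ(h₂)₂ = λ(h) 1₁ ⊗ 1₂`. -/
theorem antipode_comul : dH X ≫ H ◁ lH X ≫ H ◁ dH X ≫ cH (H ⊗ X) ≫ H ◁ mH X =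
    lH X ≫ H ◁ uH X ≫ H ◁ dH X ≫ mH (H ⊗ X) := by
  have h1 : tH X = dH X ≫ H ◁ lH X ≫ mH X := by
    rw [targetMap, convolution_eq]; simp [en]
  have h2 : lH X = dH X ≫ H ◁ tH X ≫ lH (H ⊗ X) ≫ mH X := by
    conv_lhs => rw [← WeakHopfQuasigroup.antipode_conv_target, convolution_eq]
  have h3 := mul_target_mul (H := H) (H ⊗ X)
  have h4 := congrArg (H ◁ ·) (target_comul (H := H) X)
  simp only [whiskerLeft_comp] at h4
  have h5 := congrArg (H ◁ ·) (mul_comul (H := H) X)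
  simp only [whiskerLeft_comp] at h5
  have h6 := whiskerLeft_square (comul_comul (H := H) X) H
  symm
  -- Start from λ(h) = λ(h₁)Πᴸ(h₂), reassociate around Πᴸ(h₂), and use δ(a) = a1₁ ⊗ 1₂ for a =
  -- Πᴸ(h₂).
  calc lH X ≫ H ◁ uH X ≫ H ◁ dH X ≫ mH (H ⊗ X)
      = dH X ≫ lH (H ⊗ X) ≫ H ◁ H ◁ uH X ≫ H ◁ H ◁ dH X ≫ H ◁ tH (H ⊗ H ⊗ X) ≫
          mH (H ⊗ H ⊗ X) ≫ mH (H ⊗ X) := by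
        conv_lhs => rw [h2]
        simp
    _ = dH X ≫ lH (H ⊗ X) ≫ H ◁ tH X ≫ H ◁ dH X ≫ mH (H ⊗ X) := by
        rw [h3, reassoc_of% h4]
    _ = dH X ≫ lH (H ⊗ X) ≫ H ◁ dH X ≫ H ◁ H ◁ lH X ≫ H ◁ dH (H ⊗ X) ≫
          H ◁ H ◁ H ◁ dH X ≫ H ◁ H ◁ cH (H ⊗ X) ≫ H ◁ mH (H ⊗ H ⊗ X) ≫ H ◁ H ◁ mH X ≫
          mH (H ⊗ X) := by
        rw [h1]
        simp [reassoc_of% h5]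
    -- After expanding Πᴸ(h₂) = h₂λ(h₃), coassociativity isolates a factor λ(h₁)(h₂k), which the
    -- antipode axiom turns into Πᴿ(h)k.
    _ = dH X ≫ H ◁ lH X ≫ dH (H ⊗ X) ≫ H ◁ H ◁ dH X ≫ H ◁ cH (H ⊗ X) ≫
          (dH (H ⊗ H ⊗ H ⊗ X) ≫ lH (H ⊗ H ⊗ H ⊗ H ⊗ X) ≫ H ◁ mH (H ⊗ H ⊗ X) ≫ mH (H ⊗ H ⊗ X)) ≫
          H ◁ mH X := by
        simp [reassoc_of% comul_comul (H := H), reassoc_of% h6]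
    _ = _ := by
        -- With l the antipode of the last leg of h, Πᴿ(h₁)l₁ ⊗ h₂l₂ = l₁ ⊗ ε(h₁l₂)h₂l₃, and the
        -- counit factor is absorbed into the product.
        rw [antipode_mul_mul, source_mul]
        conv_rhs => rw [mul_eq_left X]
        have h7 := whiskerLeft_square
          (br_cobin (E := H) (X := H ⊗ X) (ComonObj.comul (X := H))) H
        have h8 := cobin_br (E := H) (X := H ⊗ X) (ComonObj.comul (X := H))
        have h9 := whiskerLeft_square (whiskerLeft_square (comul_comul (H := H) X) H) H
        simp only [whiskerLeft_comp] at h7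
        simp
        rw [← reassoc_of% h7, ← reassoc_of% h8]
        simp [reassoc_of% comul_comul (H := H), reassoc_of% h9]

end Associativity
end Ctx

/-! ### The morphism q_M and its coinvariance. -/

namespace Ctx

section Module

variable {C : Type*} [Category C] [MonoidalCategory C] [BraidedCategory C]
variable {H : C} [WeakHopfQuasigroup H]

local notation "mH" => bin (UnitalMagmaObj.mul (X := H))
local notation "uH" => ins (UnitalMagmaObj.one (X := H))
local notation "dH" => cobin (ComonObj.comul (X := H))
local notation "eH" => del (ComonObj.counit (X := H))
local notation "cH" => two (Iso.hom (BraidedCategory.braiding H H))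
local notation "lH" => en (WeakHopfQuasigroupData.antipode (H := H))
local notation "tH" => en (targetMap H)
local notation "bH" => en (barSourceMap H)

variable (M : HopfModule H) (X : C)

local notation "aM" => bin (HopfModule.act M)
local notation "rM" => cobin (HopfModule.coact M)
local notation "qM" => en (HopfModule.coinvMap M)

/-- `h 1₁ ⊗ 1₂ = h₁ ⊗ Π̄ᴿ(h₂)`. -/
theorem mul_unit_comul : H ◁ uH X ≫ H ◁ dH X ≫ mH (H ⊗ X) = dH X ≫ H ◁ bH X := by
  have h1 := H ◁ uH X ≫= mul_comul (H := H) X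
  rw [reassoc_of% whiskerLeft_ins_one_bin_mul (H := H)] at h1
  have h2 := whiskerLeft_square (counit_assoc (H := H) (H ⊗ X)) H
  have h3 := congrArg (H ◁ H ◁ ·) (unit_split (H := H) X)
  have h4 := congrArg (H ◁ ·) (barSource_eq (H := H) X)
  simp only [whiskerLeft_comp] at h2 h3 h4
  conv_lhs => enter [2, 2]; rw [mul_eq_right (H ⊗ X)]
  conv_rhs => rw [h1]
  rw [h4]
  simp
  rw [← whiskerLeft_bin_nat_assoc (uH X), ← whiskerLeft_bin_nat_assoc (dH X), h2,
    reassoc_of% h3]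
  simp

theorem act_one : M.X ◁ uH X ≫ aM X = 𝟙 _ := by
  have h := congrArg (· ▷ X) M.isHopfModule.act_one
  simp only [comp_whiskerRight] at h
  have : M.X ◁ uH X ≫ aM X = M.X ◁ (λ_ X).inv ≫ (α_ _ _ _).inv ≫
    (M.X ◁ one[H]) ▷ X ≫ M.act ▷ X := by
    simp only [ins, bin]; monoidal
  rw [this, h]; monoidal

theorem coact_counit : rM X ≫ M.X ◁ eH X = 𝟙 _ := by
  have h := congrArg (· ▷ X) M.isHopfModule.coact_counit
  simp only [comp_whiskerRight] at h
  have : rM X ≫ M.X ◁ eH X = M.coact ▷ X ≫ (M.X ◁ ε[H]) ▷ X ≫ (ρ_ M.X).hom ▷ X := by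
    simp only [cobin, del]; monoidal
  rw [this, h]; monoidal

theorem coact_coact : rM X ≫ rM (H ⊗ X) = rM X ≫ M.X ◁ dH X := by
  have h := congrArg (· ▷ X) M.isHopfModule.coact_coact
  simp only [comp_whiskerRight] at h
  have h1 : rM X ≫ rM (H ⊗ X) =
      (M.coact ▷ X ≫ (M.coact ▷ H) ▷ X ≫ (α_ M.X H H).hom ▷ X) ≫ (α_ _ _ _).hom ≫
        M.X ◁ (α_ _ _ _).hom := by
    simp only [cobin]; monoidal
  rw [h1, h]
  simp only [cobin]; monoidal

theorem act_coact : aM X ≫ rM X = rM (H ⊗ X) ≫ M.X ◁ H ◁ dH X ≫ M.X ◁ cH (H ⊗ X) ≫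
    aM (H ⊗ H ⊗ X) ≫ M.X ◁ mH X := by
  have h := congrArg (· ▷ X) M.isHopfModule.act_coact
  simp only [comp_whiskerRight, MonoidalCategory.tensorHom_def, tensorμ] at h
  have h1 : aM X ≫ rM X = (α_ _ _ _).inv ≫ (M.act ▷ X ≫ M.coact ▷ X) ≫ (α_ _ _ _).hom := by
    simp only [cobin, bin]; monoidal
  rw [h1, h]
  simp only [cobin, bin, two]; monoidal

theorem act_act_antipode :
    M.X ◁ dH X ≫ aM (H ⊗ X) ≫ M.X ◁ lH X ≫ aM X = M.X ◁ tH X ≫ aM X := by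
  have h := congrArg (· ▷ X) M.isHopfModule.act_act_antipode
  simp only [comp_whiskerRight, MonoidalCategory.tensorHom_def] at h
  have h1 : M.X ◁ tH X ≫ aM X = (α_ _ _ _).inv ≫ (M.X ◁ targetMap H) ▷ X ≫ M.act ▷ X := by
    simp only [en, bin]; monoidal
  rw [h1, ← h]
  simp only [en, bin, cobin]; monoidal

theorem coinvMap_eq : qM X = rM X ≫ M.X ◁ lH X ≫ aM X := by
  simp only [HopfModule.coinvMap, en, bin, cobin]; monoidal

/-- `m h = m₀ h₁ ε(m₁ h₂)`. -/
theorem act_eq : aM X = rM (H ⊗ X) ≫ M.X ◁ H ◁ dH X ≫ M.X ◁ cH (H ⊗ X) ≫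
    aM (H ⊗ H ⊗ X) ≫ M.X ◁ mH X ≫ M.X ◁ eH X := by
  simpa [coact_counit] using act_coact M X =≫ M.X ◁ eH X

/-- `(m k) h = (m k₁) h₁ ε(k₂ h₂)`. -/
theorem act_act : aM (H ⊗ X) ≫ aM X = M.X ◁ dH (H ⊗ X) ≫ M.X ◁ H ◁ H ◁ dH X ≫
    M.X ◁ H ◁ cH (H ⊗ X) ≫ aM (H ⊗ H ⊗ H ⊗ X) ≫ aM (H ⊗ H ⊗ X) ≫ M.X ◁ mH X ≫
    M.X ◁ eH X := by
  have h1 := act_coact M (H ⊗ X)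
  have h2 := act_eq M (H ⊗ H ⊗ H ⊗ X)
  conv_lhs => rw [act_eq M X, reassoc_of% h1]
  conv_rhs => enter [2, 2, 2]; rw [h2]
  have h3 := whiskerLeft_square (bin_br (E := H) (X := H ⊗ X) (UnitalMagmaObj.mul (X := H))) M.X
  have h4 := whiskerLeft_square (counit_split (H := H) X) M.X
  have h5 := whiskerLeft_square (counit_mul_br (H := H) (H ⊗ H ⊗ X)) M.X
  have h6 := whiskerLeft_square (whiskerLeft_square
    (cobin_br (E := H) (X := H ⊗ X) (ComonObj.comul (X := H))) H) M.X
  simp only [whiskerLeft_comp] at h3 h4 h5 h6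
  have h7 := whiskerLeft_square (whiskerLeft_square (comul_comul (H := H) (H ⊗ X)) H) M.X
  simp
  rw [← whiskerLeft_bin_nat_assoc (dH X), reassoc_of% h3]
  conv_rhs => rw [← whiskerLeft_del_nat_assoc (H ◁ dH X), ← whiskerLeft_del_nat_assoc (cH (H ⊗ X)),
    ← whiskerLeft_bin_nat_assoc (H ◁ dH X), ← whiskerLeft_bin_nat_assoc (cH (H ⊗ X)),
    reassoc_of% h5]
  -- The splitting ε((m₁k₂)h₂) = ε(m₁k₂)ε(k₃h₂) allows the first factor to be reabsorbed into mk.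
  rw [bin_nat_assoc (mH (H ⊗ X)), h4, ← bin_nat_assoc (H ◁ dH (H ⊗ X)),
    ← whiskerLeft_two_nat_assoc (dH (H ⊗ X)), ← reassoc_of% h6]
  simp [reassoc_of% h7]

/-- ρ(m₀λ(m₁)) = m₀λ(m₂)₁ ⊗ m₁λ(m₂)₂. By `antipode_comul` this is m₀(λ(m₁)1₁) ⊗ 1₂, and
`mul_unit_comul` removes the unit. -/
theorem coinvMap_coact : qM X ≫ rM X =
    rM X ≫ M.X ◁ lH X ≫ M.X ◁ dH X ≫ M.X ◁ H ◁ bH X ≫ aM (H ⊗ X) := by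
  have h1 := congrArg (M.X ◁ ·) (antipode_comul (H := H) X)
  have h2 := congrArg (M.X ◁ ·) (mul_unit_comul (H := H) X)
  simp only [whiskerLeft_comp] at h1 h2
  rw [coinvMap_eq, ← reassoc_of% h2, ← reassoc_of% h1, Category.assoc, Category.assoc, act_coact]
  simp [reassoc_of% coact_coact M]

/-- `ρ(q(m) h) = q(m) h₁ ⊗ h₂`. -/
theorem coinvMap_act_coact : qM (H ⊗ X) ≫ aM X ≫ rM X =
    M.X ◁ dH X ≫ qM (H ⊗ H ⊗ X) ≫ aM (H ⊗ X) := by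
  have h1 := congrArg (M.X ◁ ·) (barSource_mul (H := H) X)
  simp only [whiskerLeft_comp] at h1
  have h2 := coinvMap_coact M (H ⊗ X)
  have h3 := whiskerLeft_square (en_br (E := H) (X := H ⊗ X) (barSourceMap H)) M.X
  have h4 := whiskerLeft_square (whiskerLeft_square (comul_comul (H := H) X) H) M.X
  rw [act_coact, reassoc_of% h2]
  rw [coinvMap_eq M (H ⊗ H ⊗ X)]
  simp
  -- For l = λ(m₁), Π̄ᴿ(l₂)h₂ = ε(l₂h₂)h₃; then `act_act` absorbs the counit factor into (m₀l)h₁.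
  rw [← whiskerLeft_en_nat_assoc (dH X), reassoc_of% h3, bin_nat_assoc (bH (H ⊗ X)), h1]
  conv_rhs => rw [← bin_nat_assoc (dH X), act_act]
  simp [reassoc_of% h4]

/-- By coinvariance q(q(m)h) = (q(m)h₁)λ(h₂), which a Hopf module axiom reduces to q(m)Πᴸ(h). Taking
h = 1 shows that q is idempotent. -/
theorem coinvMap_act_coinvMap : qM (H ⊗ X) ≫ aM X ≫ qM X = qM (H ⊗ X) ≫ M.X ◁ tH X ≫ aM X := by
  conv_lhs => rw [coinvMap_eq M X, reassoc_of% coinvMap_act_coact M X]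
  rw [← act_act_antipode]
  simp

theorem coinvMap_coinvMap : qM X ≫ qM X = qM X := by
  have h := M.X ◁ uH X ≫= coinvMap_act_coinvMap M X
  have h1 := congrArg (M.X ◁ ·) (one_target (H := H) X)
  simp only [whiskerLeft_comp] at h1
  rw [← en_nat_assoc (tH X), reassoc_of% h1] at h
  simpa [act_one, reassoc_of% act_one M] using h

end Module
end Ctx

/-! ### Constructing Hopf modules: H itself, whiskering, and split quotients. -/

namespace Ctx

section Structures

variable {C : Type*} [Category C] [MonoidalCategory C] [BraidedCategory C]
variable {H : C} [WeakHopfQuasigroup H]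

local notation "mH" => bin (UnitalMagmaObj.mul (X := H))
local notation "dH" => cobin (ComonObj.comul (X := H))
local notation "tH" => en (targetMap H)

variable (X : C)

/-- Reassociate around Πᴸ(k₁) and use Πᴸ(k₁)k₂ = k; this is the last Hopf module axiom for H over
itself. -/
theorem mul_target_mul_eq : H ◁ dH X ≫ H ◁ tH (H ⊗ X) ≫ mH (H ⊗ X) ≫ mH X = mH X := by
  have h := congrArg (H ◁ ·) (target_mul (H := H) X)
  simp only [whiskerLeft_comp, whiskerLeft_id] at h
  rw [mul_target_mul, reassoc_of% h]

end Structures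

end Ctx

section HopfModuleConstructions

open Ctx

variable {C : Type*} [Category C] [MonoidalCategory C] [BraidedCategory C]
variable {H : C} [WeakHopfQuasigroup H]

/-- `H` is a Hopf module over itself. -/
theorem isHopfModule_self : IsHopfModule H mul[H] Δ[H] where
  coact_counit := by
    rw [ComonObj.comul_counit_assoc]; simp
  coact_coact := (ComonObj.comul_assoc (X := H)).symm
  act_one := UnitalMagmaObj.mul_one
  act_coact := WeakHopfQuasigroup.mul_comul
  act_act_antipode := WeakHopfQuasigroup.mul_mul_antipode
  act_antipode_act := WeakHopfQuasigroup.mul_antipode_mul'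
  act_target_act := bin_injective fun X => by
    rw [← mul_target_mul_eq]
    simp only [bin, cobin, en]; monoidal

/-- The Hopf module `Q ⊗ X`. -/
theorem IsHopfModule.whiskerLeft {X : C} {φ : X ⊗ H ⟶ X} {r : X ⟶ X ⊗ H}
    (h : IsHopfModule H φ r) (Q : C) :
    IsHopfModule H ((α_ Q X H).hom ≫ Q ◁ φ) (Q ◁ r ≫ (α_ Q X H).inv) where
  coact_counit := by
    have e := congrArg (Q ◁ ·) h.coact_counit
    simp only [whiskerLeft_comp, whiskerLeft_id] at e
    rw [← e]; monoidal
  coact_coact := by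
    have e := congrArg (Q ◁ ·) h.coact_coact
    simp only [whiskerLeft_comp] at e
    have e' := e =≫ (α_ _ _ _).inv
    simp only [Category.assoc] at e'
    calc _ = Q ◁ r ≫ Q ◁ r ▷ H ≫ Q ◁ (α_ X H H).hom ≫ (α_ Q X (H ⊗ H)).inv := by monoidal
      _ = _ := by rw [e']; monoidal
  act_one := by
    have e := congrArg (Q ◁ ·) h.act_one
    simp only [whiskerLeft_comp] at e
    calc _ = (α_ _ _ _).hom ≫ Q ◁ X ◁ one[H] ≫ Q ◁ φ := by monoidal
      _ = _ := by rw [e]; monoidal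
  act_coact := by
    have e := congrArg (Q ◁ ·) h.act_coact
    simp only [whiskerLeft_comp] at e
    calc _ = (α_ Q X H).hom ≫ (Q ◁ φ ≫ Q ◁ r) ≫ (α_ Q X H).inv := by monoidal
      _ = _ := by
        rw [e]
        simp only [MonoidalCategory.tensorHom_def, tensorμ]
        monoidal
  act_act_antipode := by
    have e := congrArg (Q ◁ ·) h.act_act_antipode
    simp only [whiskerLeft_comp, MonoidalCategory.tensorHom_def] at e
    calc _ = (α_ Q X H).hom ≫ Q ◁ X ◁ Δ[H] ≫ Q ◁ (α_ X H H).inv ≫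
          Q ◁ (φ ▷ H ≫ X ◁ anti[H]) ≫ Q ◁ φ := by
          simp only [MonoidalCategory.tensorHom_def]; monoidal
      _ = _ := by rw [whiskerLeft_comp, e]; monoidal
  act_antipode_act := by
    have e := congrArg (Q ◁ ·) h.act_antipode_act
    simp only [whiskerLeft_comp] at e
    calc _ = (α_ Q X H).hom ≫ Q ◁ X ◁ Δ[H] ≫ Q ◁ (α_ X H H).inv ≫
          Q ◁ (X ◁ anti[H]) ▷ H ≫ Q ◁ φ ▷ H ≫ Q ◁ φ := by monoidal
      _ = _ := by rw [e]; monoidal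
  act_target_act := by
    have e := congrArg (Q ◁ ·) h.act_target_act
    simp only [whiskerLeft_comp] at e
    calc _ = (α_ Q X H).hom ≫ Q ◁ X ◁ Δ[H] ≫ Q ◁ (α_ X H H).inv ≫
          Q ◁ (X ◁ targetMap H) ▷ H ≫ Q ◁ φ ▷ H ≫ Q ◁ φ := by monoidal
      _ = _ := by rw [e]

/-- A Hopf module structure descends along a split epimorphism. -/
theorem IsHopfModule.of_splitEpi {Y X : C} {φ' : Y ⊗ H ⟶ Y} {r' : Y ⟶ Y ⊗ H}
    (h : IsHopfModule H φ' r') {φ : X ⊗ H ⟶ X} {r : X ⟶ X ⊗ H} (p : Y ⟶ X) [IsSplitEpi p]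
    (hφ : p ▷ H ≫ φ = φ' ≫ p) (hr : p ≫ r = r' ≫ p ▷ H) : IsHopfModule H φ r := by
  -- Tensoring preserves split epimorphisms, so each axiom may be checked after precomposition with
  -- p.
  have epi (Z : C) : Epi (p ▷ Z) := inferInstanceAs (Epi ((tensorRight Z).map p))
  have tens {Z Z' : C} (k : Z ⟶ Z') : p ▷ Z ≫ X ◁ k = Y ◁ k ≫ p ▷ Z' := (whisker_exchange p k).symm
  have tens' {Z Z' : C} (k : Z ⟶ Z') : p ▷ H ▷ Z ≫ (X ⊗ H) ◁ k = (Y ⊗ H) ◁ k ≫ p ▷ H ▷ Z' :=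
    (whisker_exchange (p ▷ H) k).symm
  have hφ' : p ▷ H ▷ H ≫ φ ▷ H = φ' ▷ H ≫ p ▷ H := by
    rw [← comp_whiskerRight, hφ, comp_whiskerRight]
  have anat : p ▷ (H ⊗ H) ≫ (α_ X H H).inv = (α_ Y H H).inv ≫ p ▷ H ▷ H :=
    associator_inv_naturality_left p H H
  have wnat (k : H ⟶ H) : p ▷ H ▷ H ≫ (X ◁ k) ▷ H = (Y ◁ k) ▷ H ≫ p ▷ H ▷ H := by
    rw [← comp_whiskerRight, tens, comp_whiskerRight]
  constructor
  · rw [← cancel_epi p, reassoc_of% hr, reassoc_of% tens, rightUnitor_naturality,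
      reassoc_of% h.coact_counit, Category.comp_id]
  · rw [← cancel_epi p, reassoc_of% hr, reassoc_of% hr, ← comp_whiskerRight_assoc, hr, tens,
      ← reassoc_of% h.coact_coact]
    simp
  · rw [← cancel_epi (p ▷ 𝟙_ C), reassoc_of% tens, hφ, rightUnitor_naturality,
      reassoc_of% h.act_one]
  · rw [← cancel_epi (p ▷ H), reassoc_of% hφ, hr, reassoc_of% h.act_coact]
    have e1 : p ▷ H ≫ (r ⊗ₘ Δ[H]) = (r' ⊗ₘ Δ[H]) ≫ p ▷ H ▷ (H ⊗ H) := by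
      rw [tensorHom_def', reassoc_of% tens, ← comp_whiskerRight, hr, tensorHom_def']
      simp
    have e2 : p ▷ H ▷ (H ⊗ H) ≫ tensorμ X H H H = tensorμ Y H H H ≫ p ▷ H ▷ (H ⊗ H) := by
      simpa using tensorμ_natural_left p (𝟙 H) H H
    have e3 : p ▷ H ▷ (H ⊗ H) ≫ (φ ⊗ₘ mul[H]) = (φ' ⊗ₘ mul[H]) ≫ p ▷ H := by
      rw [MonoidalCategory.tensorHom_def, ← comp_whiskerRight_assoc, hφ, MonoidalCategory.tensorHom_def, Category.assoc,
        comp_whiskerRight_assoc, tens]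
    rw [reassoc_of% e1, reassoc_of% e2, e3]
  · rw [← cancel_epi (p ▷ H), reassoc_of% tens, reassoc_of% tens, hφ,
      ← reassoc_of% h.act_act_antipode, reassoc_of% anat, MonoidalCategory.tensorHom_def,
      MonoidalCategory.tensorHom_def,
      Category.assoc, reassoc_of% hφ', reassoc_of% tens, hφ]
    simp
  · rw [← cancel_epi (p ▷ H), reassoc_of% tens, reassoc_of% tens, hφ,
      ← reassoc_of% h.act_antipode_act, reassoc_of% anat, reassoc_of% wnat, reassoc_of% hφ', hφ]
  · rw [← cancel_epi (p ▷ H), reassoc_of% tens, hφ, reassoc_of% anat, reassoc_of% wnat,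
      reassoc_of% hφ', hφ]
    conv_rhs => rw [← h.act_target_act]
    simp

end HopfModuleConstructions

/-! ### Split idempotents and the monoid H_L. -/

namespace IdempotentSplitting

variable {C : Type*} [Category C] {X : C} {e : X ⟶ X} (S : IdempotentSplitting e)

theorem ι_comp : S.ι ≫ e = S.ι := by
  simpa [reassoc_of% S.ι_π] using (S.ι ≫= S.π_ι).symm

theorem comp_π : e ≫ S.π = S.π := by
  simpa [S.ι_π] using (S.π_ι =≫ S.π).symm

instance : IsSplitMono S.ι := ⟨⟨⟨S.π, S.ι_π⟩⟩⟩

instance : IsSplitEpi S.π := ⟨⟨⟨S.ι, S.ι_π⟩⟩⟩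

end IdempotentSplitting

section Target

open Ctx

variable {C : Type*} [Category C] [MonoidalCategory C] [BraidedCategory C]
variable {H : C} [WeakHopfQuasigroup H]

theorem targetMap_targetMap : targetMap H ≫ targetMap H = targetMap H :=
  en_injective fun X => by rw [en_comp, target_target]

theorem one_targetMap : one[H] ≫ targetMap H = one[H] := by
  have h := one_target (H := H) (𝟙_ C)
  simp only [ins, en, Category.assoc, ← comp_whiskerRight, Iso.cancel_iso_inv_left] at h
  simpa using h =≫ (ρ_ H).hom

variable (L : IdempotentSplitting (targetMap H))

theorem targetOne_ι : targetOne L ≫ L.ι = one[H] := by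
  rw [targetOne, Category.assoc, L.π_ι, one_targetMap]

/-- The image of Πᴸ is closed under the product, since Πᴸ(ah) = aΠᴸ(h) for a in that image. -/
theorem targetMul_ι : targetMul L ≫ L.ι = (L.ι ⊗ₘ L.ι) ≫ mul[H] := by
  have h : targetMap H ▷ H ≫ mul[H] ≫ targetMap H =
      targetMap H ▷ H ≫ H ◁ targetMap H ≫ mul[H] := bin_injective fun X => by
    have h := target_mul_target (H := H) X
    calc _ = en (targetMap H) (H ⊗ X) ≫ bin mul[H] X ≫ en (targetMap H) X := by
          simp only [bin, en]; monoidal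
      _ = _ := by rw [h]; simp only [bin, en]; monoidal
  have h' := L.ι ▷ H ≫= h
  rw [← comp_whiskerRight_assoc, ← comp_whiskerRight_assoc, L.ι_comp] at h'
  rw [targetMul, Category.assoc, Category.assoc, L.π_ι, MonoidalCategory.tensorHom_def',
    Category.assoc, h', ← whisker_exchange_assoc, ← whiskerLeft_comp_assoc, L.ι_comp,
    Category.assoc]

theorem targetMap_mul_mul : targetMap H ▷ H ▷ H ≫ mul[H] ▷ H ≫ mul[H] =
    (α_ H H H).hom ≫ targetMap H ▷ (H ⊗ H) ≫ H ◁ mul[H] ≫ mul[H] := by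
  refine en_injective fun X => ?_
  have h := target_mul_mul (H := H) X
  calc _ = (α_ _ _ _).hom ≫ (α_ _ _ _).hom ≫ en (targetMap H) (H ⊗ H ⊗ X) ≫
        bin mul[H] (H ⊗ X) ≫ bin mul[H] X := by
        simp only [bin, en]; monoidal
    _ = _ := by rw [h]; simp only [bin, en]; monoidal

theorem isTargetMonoid : IsTargetMonoid L where
  one_mul := by
    rw [← cancel_mono L.ι, Category.assoc, targetMul_ι, MonoidalCategory.tensorHom_def,
      Category.assoc, ← comp_whiskerRight_assoc, targetOne_ι, ← whisker_exchange_assoc,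
      UnitalMagmaObj.one_mul, leftUnitor_naturality]
  mul_one := by
    rw [← cancel_mono L.ι, Category.assoc, targetMul_ι, MonoidalCategory.tensorHom_def',
      Category.assoc, ← whiskerLeft_comp_assoc, targetOne_ι, whisker_exchange_assoc,
      UnitalMagmaObj.mul_one, rightUnitor_naturality]
  mul_assoc := by
    have h := (L.ι ▷ H) ▷ H ≫= targetMap_mul_mul (H := H)
    rw [← comp_whiskerRight_assoc, ← comp_whiskerRight (L.ι), L.ι_comp,
      associator_naturality_left_assoc, ← comp_whiskerRight_assoc L.ι _ (H ⊗ H), L.ι_comp] at h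
    rw [← cancel_mono L.ι, Category.assoc, Category.assoc, Category.assoc, targetMul_ι]
    conv_lhs => rw [MonoidalCategory.tensorHom_def, Category.assoc, ← comp_whiskerRight_assoc,
      targetMul_ι, MonoidalCategory.tensorHom_def']
    conv_rhs => rw [MonoidalCategory.tensorHom_def', Category.assoc, ← whiskerLeft_comp_assoc,
      targetMul_ι]
    simp only [comp_whiskerRight, Category.assoc, ← whisker_exchange_assoc]
    rw [h]
    simp [MonoidalCategory.tensorHom_def', whisker_exchange_assoc]
    rw [← whiskerLeft_comp_assoc L.obj (L.obj ◁ L.ι), whisker_exchange]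
    simp

end Target

/-! ### ∇_M in terms of the action of H_L. -/

namespace Ctx

section Strong

variable {C : Type*} [Category C] [MonoidalCategory C] [BraidedCategory C]
variable {H : C} [WeakHopfQuasigroup H] (M : HopfModule H)
variable (L : IdempotentSplitting (targetMap H)) (Q : IdempotentSplitting M.coinvMap) (X : C)

local notation "mH" => bin (UnitalMagmaObj.mul (X := H))
local notation "dH" => cobin (ComonObj.comul (X := H))
local notation "tH" => en (targetMap H)
local notation "aM" => bin (HopfModule.act M)
local notation "rM" => cobin (HopfModule.coact M)
local notation "qM" => en (HopfModule.coinvMap M)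
local notation "iL" => en (IdempotentSplitting.ι L)
local notation "pL" => en (IdempotentSplitting.π L)
local notation "iQ" => en (IdempotentSplitting.ι Q)
local notation "pQ" => en (IdempotentSplitting.π Q)

theorem coinvAct_eq : bin (M.coinvAct Q L) X =
    iQ (L.obj ⊗ X) ≫ M.X ◁ iL X ≫ aM X ≫ pQ X := by
  simp only [HopfModule.coinvAct, MonoidalCategory.tensorHom_def, bin, en]; monoidal

theorem nabla_eq : two (M.nabla Q) X = iQ (H ⊗ X) ≫ aM X ≫ rM X ≫ pQ (H ⊗ X) := by
  simp only [HopfModule.nabla, bin, cobin, two, en]; monoidal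

theorem ι_act_coinvMap :
    iQ (H ⊗ X) ≫ aM X ≫ qM X = iQ (H ⊗ X) ≫ M.X ◁ tH X ≫ aM X := by
  have h := coinvMap_act_coinvMap M X
  have e : iQ (H ⊗ X) = iQ (H ⊗ X) ≫ qM (H ⊗ X) := by rw [← en_comp, Q.ι_comp]
  rw [e, Category.assoc, h, Category.assoc]

/-- Coinvariants are stable under H_L: q(ma) = mΠᴸ(a) = ma for m in M^{coH} and a in H_L. -/
theorem coinvAct_ι : bin (M.coinvAct Q L) X ≫ iQ X = iQ (L.obj ⊗ X) ≫ M.X ◁ iL X ≫ aM X := by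
  have h := ι_act_coinvMap M Q X
  have e : iL X ≫ tH X = iL X := by rw [← en_comp, L.ι_comp]
  have e' := congrArg (M.X ◁ ·) e
  simp only [whiskerLeft_comp] at e'
  rw [coinvAct_eq]
  simp only [Category.assoc]
  rw [← en_comp, Q.π_ι, ← en_nat_assoc, h, en_nat_assoc, reassoc_of% e']

/-- Coinvariance gives ∇(m ⊗ h) = p_M(mh₁) ⊗ h₂. Since p_M = p_M ∘ q, the factor mh₁ may be replaced
by q(mh₁) = mΠᴸ(h₁). -/
theorem nabla_eq_coinvAct :
    two (M.nabla Q) X = Q.obj ◁ dH X ≫ Q.obj ◁ pL (H ⊗ X) ≫ bin (M.coinvAct Q L) (H ⊗ X) := by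
  have h := coinvMap_act_coact M X
  have e (Y : C) : iQ Y = iQ Y ≫ qM Y := by rw [← en_comp, Q.ι_comp]
  have e' (Y : C) : pQ Y = qM Y ≫ pQ Y := by rw [← en_comp, Q.comp_π]
  have e2 (Y : C) : pL Y ≫ iL Y = tH Y := by rw [← en_comp, L.π_ι]
  rw [nabla_eq, e, Category.assoc, reassoc_of% h, coinvAct_eq]
  rw [← en_nat_assoc, ← reassoc_of% (e (H ⊗ H ⊗ X)), e' (H ⊗ X),
    reassoc_of% ι_act_coinvMap M Q (H ⊗ X), ← e' (H ⊗ X)]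
  rw [en_nat_assoc (pL (H ⊗ X)), ← whiskerLeft_comp_assoc, e2]

variable {L Q} {Z : C} {t : Q.obj ⊗ H ⟶ Z}

theorem coequalizes_apply
    (w : M.coinvAct Q L ▷ H ≫ t = ((α_ Q.obj L.obj H).hom ≫ Q.obj ◁ targetLeftAct L) ≫ t) :
    bin (M.coinvAct Q L) (H ⊗ X) ≫ bin t X =
      Q.obj ◁ iL (H ⊗ X) ≫ Q.obj ◁ mH X ≫ bin t X := by
  have h := congrArg (· ▷ X) w
  simp only [comp_whiskerRight, targetLeftAct] at h
  calc _ = (α_ _ _ _).inv ≫ (α_ _ _ _).inv ≫ M.coinvAct Q L ▷ H ▷ X ≫ t ▷ X := by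
        simp only [bin]; monoidal
    _ = _ := by rw [h]; simp only [bin, en]; monoidal

/-- Move Πᴸ(h₁) across the tensor sign and use Πᴸ(h₁)h₂ = h. -/
theorem nabla_coequalizes
    (w : M.coinvAct Q L ▷ H ≫ t = ((α_ Q.obj L.obj H).hom ≫ Q.obj ◁ targetLeftAct L) ≫ t) :
    two (M.nabla Q) X ≫ bin t X = bin t X := by
  have h := congrArg (Q.obj ◁ ·) (target_mul (H := H) X)
  simp only [whiskerLeft_comp, whiskerLeft_id] at h
  have e2 : pL (H ⊗ X) ≫ iL (H ⊗ X) = tH (H ⊗ X) := by rw [← en_comp, L.π_ι]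
  rw [nabla_eq_coinvAct M L Q, Category.assoc, Category.assoc, coequalizes_apply M X w,
    ← whiskerLeft_comp_assoc Q.obj (pL _), e2, reassoc_of% h]

/-- As before, but with Πᴸ(h₁)(h₂k) = (Πᴸ(h₁)h₂)k = hk; it makes p compatible with right
multiplication. -/
theorem nabla_mul_coequalizes
    (w : M.coinvAct Q L ▷ H ≫ t = ((α_ Q.obj L.obj H).hom ≫ Q.obj ◁ targetLeftAct L) ≫ t) :
    two (M.nabla Q) (H ⊗ X) ≫ Q.obj ◁ mH X ≫ bin t X = Q.obj ◁ mH X ≫ bin t X := by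
  have h := congrArg (Q.obj ◁ ·) (target_mul_mul (H := H) X)
  have h1 := congrArg (Q.obj ◁ ·) (target_mul (H := H) (H ⊗ X))
  simp only [whiskerLeft_comp, whiskerLeft_id] at h h1
  have e2 : pL (H ⊗ H ⊗ X) ≫ iL (H ⊗ H ⊗ X) = tH (H ⊗ H ⊗ X) := by rw [← en_comp, L.π_ι]
  rw [nabla_eq_coinvAct M L Q, Category.assoc, Category.assoc, ← bin_nat_assoc,
    coequalizes_apply M X w, whiskerLeft_en_nat_assoc,
    ← whiskerLeft_comp_assoc Q.obj (pL _), e2, ← reassoc_of% h, reassoc_of% h1]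

theorem nabla_comul (L : IdempotentSplitting (targetMap H)) :
    two (M.nabla Q) X ≫ Q.obj ◁ dH X = Q.obj ◁ dH X ≫ two (M.nabla Q) (H ⊗ X) := by
  have h := whiskerLeft_square (comul_comul (H := H) X) Q.obj
  rw [nabla_eq_coinvAct M L Q, nabla_eq_coinvAct M L Q]
  simp [reassoc_of% h]

end Strong

end Ctx

/-! ### The universal property of p and the induced Hopf module structures. -/

namespace HopfModule

open Ctx

variable {C : Type*} [Category C] [MonoidalCategory C] [BraidedCategory C]
variable {H : C} [WeakHopfQuasigroup H] (M : HopfModule H)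

theorem coinvMap_coinvMap : M.coinvMap ≫ M.coinvMap = M.coinvMap :=
  en_injective fun X => by rw [en_comp, Ctx.coinvMap_coinvMap]

variable (L : IdempotentSplitting (targetMap H)) (Q : IdempotentSplitting M.coinvMap)

theorem coinvAct_ι : M.coinvAct Q L ≫ Q.ι = (Q.ι ⊗ₘ L.ι) ≫ M.act := bin_injective fun X => by
  have h := Ctx.coinvAct_ι M L Q X
  calc _ = bin (M.coinvAct Q L) X ≫ en Q.ι X := by simp only [bin, en]; monoidal
    _ = _ := by rw [h]; simp only [MonoidalCategory.tensorHom_def, bin, en]; monoidal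

variable {L}

theorem isRightTargetModule (hS : M.IsStrong L) : IsRightTargetModule L (M.coinvAct Q L) where
  act_one := by
    rw [← cancel_mono Q.ι, Category.assoc, coinvAct_ι, MonoidalCategory.tensorHom_def',
      Category.assoc, ← whiskerLeft_comp_assoc, targetOne_ι, whisker_exchange_assoc,
      M.isHopfModule.act_one, rightUnitor_naturality]
  act_act := by
    have h : _ = _ := hS
    have h' := Q.ι ▷ L.obj ▷ L.obj ≫= ((M.X ⊗ L.obj) ◁ L.ι ≫= h)
    rw [← cancel_mono Q.ι, Category.assoc, Category.assoc, Category.assoc, coinvAct_ι]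
    conv_lhs => rw [MonoidalCategory.tensorHom_def, Category.assoc, ← comp_whiskerRight_assoc,
      coinvAct_ι, MonoidalCategory.tensorHom_def]
    conv_rhs => rw [MonoidalCategory.tensorHom_def', Category.assoc, ← whiskerLeft_comp_assoc,
      targetMul_ι]
    simp only [comp_whiskerRight, Category.assoc, ← whisker_exchange_assoc] at h' ⊢
    rw [← comp_whiskerRight_assoc (Q.obj ◁ L.ι), whisker_exchange, comp_whiskerRight_assoc, h',
      associator_naturality_left_assoc, associator_naturality_right_assoc]
    simp only [whiskerLeft_comp, MonoidalCategory.tensorHom_def', Category.assoc]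
    rw [← whisker_exchange_assoc Q.ι (L.ι ▷ H), ← whisker_exchange_assoc Q.ι]

/-- This is strongness, (ma)h = m(ah), restricted to coinvariant m. -/
theorem omega_coequalizes (hS : M.IsStrong L) : M.coinvAct Q L ▷ H ≫ M.omega Q =
    ((α_ Q.obj L.obj H).hom ≫ Q.obj ◁ targetLeftAct L) ≫ M.omega Q := by
  have h : _ = _ := hS
  rw [omega, ← comp_whiskerRight_assoc, coinvAct_ι, MonoidalCategory.tensorHom_def]
  simp only [comp_whiskerRight, Category.assoc]
  rw [h, targetLeftAct, whisker_exchange_assoc, associator_naturality_left_assoc]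

variable (T : IdempotentSplitting (M.nabla Q))

/-- p = p ∘ ∇ = p ∘ ω′ ∘ ω factors through ω. -/
theorem π_coequalizes (hS : M.IsStrong L) : M.coinvAct Q L ▷ H ≫ T.π =
    ((α_ Q.obj L.obj H).hom ≫ Q.obj ◁ targetLeftAct L) ≫ T.π := by
  have h := M.omega_coequalizes Q hS
  have e : M.omega Q ≫ M.omega' Q ≫ T.π = T.π := by
    rw [← Category.assoc, ← M.nabla_eq Q, T.comp_π]
  rw [← e, reassoc_of% h]
  simp

theorem nabla_nabla : M.nabla Q ≫ M.nabla Q = M.nabla Q := by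
  rw [M.nabla_eq, Category.assoc, reassoc_of% M.omega'_omega Q]

variable {Q} {Z : C} {t : Q.obj ⊗ H ⟶ Z}

theorem nabla_coequalizes
    (w : M.coinvAct Q L ▷ H ≫ t = ((α_ Q.obj L.obj H).hom ≫ Q.obj ◁ targetLeftAct L) ≫ t) :
    M.nabla Q ≫ t = t := bin_injective fun X => by
  have h := Ctx.nabla_coequalizes M X w
  rw [← h]
  simp only [bin, two]; monoidal

/-- The projection onto the image of `M.nabla Q` is a coequalizer. -/
def isColimitπ (w : M.coinvAct Q L ▷ H ≫ T.π =
    ((α_ Q.obj L.obj H).hom ≫ Q.obj ◁ targetLeftAct L) ≫ T.π) : IsColimit (Cofork.ofπ T.π w) :=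
  Cofork.IsColimit.mk _ (fun s => T.ι ≫ s.π)
    (fun s => by
      have h := M.nabla_coequalizes (L := L) s.condition
      simp only [Cofork.π_ofπ]
      rw [reassoc_of% T.π_ι, h])
    (fun s m hm => by
      simp only [Cofork.π_ofπ] at hm
      rw [← hm, reassoc_of% T.ι_π])

theorem π_prodAct (w : M.coinvAct Q L ▷ H ≫ T.π =
    ((α_ Q.obj L.obj H).hom ≫ Q.obj ◁ targetLeftAct L) ≫ T.π) :
    T.π ▷ H ≫ M.prodAct Q T = ((α_ Q.obj H H).hom ≫ Q.obj ◁ mul[H]) ≫ T.π := by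
  rw [prodAct, ← comp_whiskerRight_assoc, T.π_ι]
  refine en_injective fun X => ?_
  have h := nabla_mul_coequalizes M X w
  calc _ = (α_ _ _ _).hom ≫ (α_ _ _ _).hom ≫ two (M.nabla Q) (H ⊗ X) ≫
        Q.obj ◁ bin mul[H] X ≫ bin T.π X := by
        simp only [bin, two, en]; monoidal
    _ = _ := by rw [h]; simp only [bin, en]; monoidal

theorem π_prodCoact (L : IdempotentSplitting (targetMap H)) :
    T.π ≫ M.prodCoact Q T = (Q.obj ◁ Δ[H] ≫ (α_ Q.obj H H).inv) ≫ T.π ▷ H := by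
  have h : M.nabla Q ≫ Q.obj ◁ Δ[H] ≫ (α_ Q.obj H H).inv =
      Q.obj ◁ Δ[H] ≫ (α_ Q.obj H H).inv ≫ M.nabla Q ▷ H := by
    refine en_injective fun X => ?_
    have h := nabla_comul M (Q := Q) X L
    calc _ = (α_ _ _ _).hom ≫ (two (M.nabla Q) X ≫ Q.obj ◁ cobin Δ[H] X) ≫ (α_ _ _ _).inv ≫
          (α_ _ _ _).inv := by
          simp only [two, cobin, en]; monoidal
      _ = _ := by rw [h]; simp only [two, cobin, en]; monoidal
  rw [prodCoact, reassoc_of% T.π_ι, reassoc_of% h, ← comp_whiskerRight, T.comp_π]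
  simp

/-- M^{coH} × H is the quotient of the Hopf module M^{coH} ⊗ H along the split epimorphism p. -/
theorem isHopfModule_prod (w : M.coinvAct Q L ▷ H ≫ T.π =
    ((α_ Q.obj L.obj H).hom ≫ Q.obj ◁ targetLeftAct L) ≫ T.π) :
    IsHopfModule H (M.prodAct Q T) (M.prodCoact Q T) :=
  (isHopfModule_self.whiskerLeft Q.obj).of_splitEpi T.π (M.π_prodAct T w) (M.π_prodCoact T L)

/-- An isomorphism of the underlying objects that commutes with the actions and the coactions is
an isomorphism of Hopf modules. -/
def isoMk {M N : HopfModule H} (e : M.X ≅ N.X) (ha : e.hom ▷ H ≫ N.act = M.act ≫ e.hom)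
    (hc : e.hom ≫ N.coact = M.coact ≫ e.hom ▷ H) : M ≅ N := by
  have hq : e.hom ≫ N.coinvMap = M.coinvMap ≫ e.hom := by
    simp only [coinvMap, Category.assoc]
    rw [reassoc_of% hc, ← whisker_exchange_assoc, ha]
  have hQ : e.hom ▷ H ≫ N.quasiAct = M.quasiAct ≫ e.hom := by
    simp only [quasiAct, Category.assoc]
    rw [← comp_whiskerRight_assoc, hc, comp_whiskerRight_assoc, associator_naturality_left_assoc,
      MonoidalCategory.tensorHom_def, Category.assoc, ← comp_whiskerRight_assoc, hq,
      MonoidalCategory.tensorHom_def, comp_whiskerRight_assoc, ← whisker_exchange_assoc, ha]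
    simp
  exact
    { hom := ⟨e.hom, hc, hQ⟩
      inv := ⟨e.inv,
        by rw [Iso.inv_comp_eq, reassoc_of% hc, ← comp_whiskerRight, e.hom_inv_id]; simp,
        by rw [← cancel_epi (e.hom ▷ H), ← comp_whiskerRight_assoc, e.hom_inv_id,
            reassoc_of% hQ]; simp⟩
      hom_inv_id := Hom.ext e.hom_inv_id
      inv_hom_id := Hom.ext e.inv_hom_id }

end HopfModule

/-! ### The main theorem. -/

theorem proposition3p9 {C : Type*} [Category C] [MonoidalCategory C] [BraidedCategory C]
    [HasCoequalizers C] (H : C) [WeakHopfQuasigroup H]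
    [PreservesColimitsOfShape WalkingParallelPair (tensorRight H)] :
    -- the target morphism is idempotent, and its image `L = H_L` is a monoid
    targetMap H ≫ targetMap H = targetMap H ∧
    ∀ L : IdempotentSplitting (targetMap H), IsTargetMonoid L ∧
    ∀ M : HopfModule H, M.IsStrong L →
    -- `q_M` is idempotent, and its image `Q = M^{coH}` is a right `H_L`-module
    M.coinvMap ≫ M.coinvMap = M.coinvMap ∧
    ∀ Q : IdempotentSplitting M.coinvMap, IsRightTargetModule L (M.coinvAct Q L) ∧
    -- `∇_M` is idempotent, and its image `T = M^{coH} × H` is a Hopf module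
    M.nabla Q ≫ M.nabla Q = M.nabla Q ∧
    ∀ T : IdempotentSplitting (M.nabla Q),
    ∃ hT : IsHopfModule H (M.prodAct Q T) (M.prodCoact Q T),
    -- the induced structure exists and makes `M^{coH} ⊗_{H_L} H` a Hopf module
    ∃ (φ : tensorTarget L (M.coinvAct Q L) ⊗ H ⟶ tensorTarget L (M.coinvAct Q L))
      (ρ : tensorTarget L (M.coinvAct Q L) ⟶ tensorTarget L (M.coinvAct Q L) ⊗ H),
    IsInduced L (M.coinvAct Q L) φ ρ ∧
    ∃ hI : IsHopfModule H φ ρ,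
    -- the two Hopf modules are isomorphic, compatibly with the projections
    (∃ s : HopfModule.mk (tensorTarget L (M.coinvAct Q L)) φ ρ hI ≅
          HopfModule.mk T.obj (M.prodAct Q T) (M.prodCoact Q T) hT,
        tensorTargetπ L (M.coinvAct Q L) ≫ s.hom.hom = T.π) ∧
    -- the projection onto `M^{coH} × H` is a coequalizer
    ∃ w : M.coinvAct Q L ▷ H ≫ T.π =
        ((α_ Q.obj L.obj H).hom ≫ Q.obj ◁ targetLeftAct L) ≫ T.π,
      Nonempty (IsColimit (Cofork.ofπ T.π w)) := by
  refine ⟨targetMap_targetMap, fun L => ⟨isTargetMonoid L, fun M hS =>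
    ⟨M.coinvMap_coinvMap, fun Q => ⟨M.isRightTargetModule Q hS, M.nabla_nabla Q, fun T => ?_⟩⟩⟩⟩
  have w := M.π_coequalizes Q T hS
  have hT := M.isHopfModule_prod T w
  -- Both n and p are coequalizers of the same pair; e is the comparison isomorphism.
  let e : tensorTarget L (M.coinvAct Q L) ≅ T.obj :=
    (colimit.isColimit _).coconePointUniqueUpToIso (M.isColimitπ T w)
  have he : tensorTargetπ L (M.coinvAct Q L) ≫ e.hom = T.π :=
    (colimit.isColimit _).comp_coconePointUniqueUpToIso_hom (M.isColimitπ T w)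
      WalkingParallelPair.one
  have he' : T.π ≫ e.inv = tensorTargetπ L (M.coinvAct Q L) := by rw [← he]; simp
  -- The action and coaction on M^{coH} ⊗_{H_L} H are those of M^{coH} × H conjugated by e;
  -- unification with `hI` supplies them as the witnesses below.
  have ha : e.inv ▷ H ≫ e.hom ▷ H ≫ M.prodAct Q T ≫ e.inv = M.prodAct Q T ≫ e.inv := by simp
  have hc : e.inv ≫ e.hom ≫ M.prodCoact Q T ≫ e.inv ▷ H = M.prodCoact Q T ≫ e.inv ▷ H := by simp
  have hI := hT.of_splitEpi e.inv ha hc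
  refine ⟨hT, _, _, ⟨?_, ?_⟩, hI, ⟨HopfModule.isoMk e ?_ ?_, he⟩, w, ⟨M.isColimitπ T w⟩⟩
  · rw [← comp_whiskerRight_assoc, he, reassoc_of% M.π_prodAct T w, he']
  · rw [reassoc_of% he, reassoc_of% M.π_prodCoact T L, ← comp_whiskerRight, he']
  · simp
  · simp [← comp_whiskerRight]
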